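/- Let $\lambda_n=(4n+1)(4n+2)^2(4n+3)$ and $\mu_n=(4n-1)(4n)^2(4n+1)$ $(n\ge 0)$ be the birth and death rates of the Berg–Valent quartic-rate birth and death process, let $Q$ be its generator, $(Qf)(n)=\lambda_n f(n+1)+\mu_n f(n-1)-(\lambda_n+\mu_n)f(n)$, and let $\sigma_n=((-Q)^n)_{00}$ be the moments of the associated Stieltjes moment problem. The symmetrized moment problem has moments $s_{2n}=\sigma_n$, $s_{2n+1}=0$. It has a sequence of orthonormal polynomials $p_n$ ($\deg p_n=n$, positive leading coefficient, $\mathcal L(p_mp_n)=\delta_{mn}$ where $\mathcal L$ is the linear functional on polynomials with $\mathcal L(x^n)=s_n$). Let $q_n(x)=\mathcal L_y\big(\frac{p_n(x)-p_n(y)}{x-y}\big)$ be the polynomials of the second kind, and $$B(z)=-1+z\sum_{k\ge0}q_k(0)p_k(z),\qquad D(z)=z\sum_{k\ge0}p_k(0)p_k(z),\qquad K_0=\frac{\Gamma(1/4)\Gamma(5/4)}{\sqrt\pi}.$$ Then for every $z\in\mathbb C$ the series $\sum_k|p_k(z)|^2$ and those defining $B(z)$ and $D(z)$ converge, and for every real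 $\theta$ with $\sin\theta\ne0$ $$\sum_{n=0}^\infty|p_n(e^{i\theta})|^2=\frac{B(e^{i\theta})D(e^{-i\theta})-B(e^{-i\theta})D(e^{i\theta})}{e^{i\theta}-e^{-i\theta}}=\frac{1}{\pi\sin\theta}\Big\{\sinh[K_0\cos(\theta/2)]\sinh[K_0\sin(\theta/2)]+\sin[K_0\cos(\theta/2)]\sin[K_0\sin(\theta/2)]\Big\}.$$ Consequently $\theta\mapsto\sum_n|p_n(e^{i\theta})|^2$ is integrable on $[0,2\pi]$, the double series below converges, and $$\rho_0=\int_0^{2\pi}\sum_{n=0}^\infty|p_n(e^{i\theta})|^2\,\frac{d\theta}{2\pi}=\frac{K_0^2}{\pi}\sum_{\substack{m,n\ge0\\ m+n\ \mathrm{even}}}\frac{(K_0/2)^{2m+2n}}{(2m+1)(2n+1)\,m!\,n!\,(m+n)!}.$$ -/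

import Mathlib

/-- Birth rates `λ_n = (4n+1)(4n+2)²(4n+3)` of the quartic birth and death process. -/
noncomputable def birthRate (n : ℕ) : ℝ := (4 * n + 1) * (4 * n + 2) ^ 2 * (4 * n + 3)

/-- Death rates `μ_n = (4n-1)(4n)²(4n+1)` of the quartic birth and death process; `μ_0 = 0`. -/
noncomputable def deathRate (n : ℕ) : ℝ := (4 * n - 1) * (4 * n) ^ 2 * (4 * n + 1)

/-- Minus the generator of the birth and death process with rates `lam`, `mu`, acting on
functions of the state: `(-Q f)(n) = (λ_n + μ_n) f(n) - λ_n f(n+1) - μ_n f(n-1)`.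
(For `mu 0 = 0` the last term is absent at `n = 0`.) -/
def negGenerator (lam mu : ℕ → ℝ) (f : ℕ → ℝ) : ℕ → ℝ := fun n =>
  (lam n + mu n) * f n - lam n * f (n + 1) - mu n * f (n - 1)

/-- The moments `s_n = ((-Q)^n)_{00}` of the Stieltjes moment problem attached to the birth and
death process with rates `lam`, `mu`. -/
def birthDeathMoment (lam mu : ℕ → ℝ) (n : ℕ) : ℝ :=
  ((negGenerator lam mu)^[n] (Pi.single 0 1)) 0

/-- The moments of the symmetrized problem: the even moments are `s_0, s_1, s_2, …`
and the odd moments vanish. -/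
def symmetrizedMoment (s : ℕ → ℝ) (n : ℕ) : ℝ := if Even n then s (n / 2) else 0

/-- The moments of the symmetrized quartic-rate problem. -/
noncomputable def quarticMoment : ℕ → ℝ :=
  symmetrizedMoment (birthDeathMoment birthRate deathRate)

/-- The moment functional `x ^ n ↦ s_n`; it is `f ↦ ∫ f dα` for every measure `α` having the
moments `s_n`. -/
def momentFunctional (s : ℕ → ℝ) (f : Polynomial ℝ) : ℝ := f.sum fun j a => a * s j

/-- `p` is the sequence of orthonormal polynomials of the moment sequence `s`: `p n` has degree
`n` and positive leading coefficient, and the `p n` are orthonormal. -/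
structure IsOrthonormalPolys (s : ℕ → ℝ) (p : ℕ → Polynomial ℝ) : Prop where
  natDegree_eq : ∀ n, (p n).natDegree = n
  leadingCoeff_pos : ∀ n, 0 < (p n).leadingCoeff
  orthonormal : ∀ m n, momentFunctional s (p m * p n) = if m = n then 1 else 0

/-- The polynomial of the second kind of `f`, i.e. the moment functional applied in the variable
`y` to `(f(x) - f(y)) / (x - y)`, using `(x^j - y^j) / (x - y) = ∑_{i<j} x^i y^(j-1-i)`. -/
noncomputable def secondKind (s : ℕ → ℝ) (f : Polynomial ℝ) : Polynomial ℝ :=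
  f.sum fun j a => ∑ i ∈ Finset.range j, Polynomial.monomial i (a * s (j - 1 - i))

/-- The Nevanlinna function `B(z) = -1 + z ∑ q_k(0) p_k(z)`, with `q_k` the polynomials of the
second kind. -/
noncomputable def nevanlinnaB (s : ℕ → ℝ) (p : ℕ → Polynomial ℝ) (z : ℂ) : ℂ :=
  -1 + z * ∑' k, (((secondKind s (p k)).eval 0 : ℝ) : ℂ) * Polynomial.aeval z (p k)

/-- The Nevanlinna function `D(z) = z ∑ p_k(0) p_k(z)`. -/
noncomputable def nevanlinnaD (p : ℕ → Polynomial ℝ) (z : ℂ) : ℂ :=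
  z * ∑' k, (((p k).eval 0 : ℝ) : ℂ) * Polynomial.aeval z (p k)

/-- The point `e^{iθ}` of the unit circle. -/
noncomputable def circlePoint (θ : ℝ) : ℂ := Complex.exp (θ * Complex.I)

/-- `ρ₀ = ∫_0^{2π} ∑ |p_k(e^{iθ})|² dθ / 2π`. -/
noncomputable def rhoZero (p : ℕ → Polynomial ℝ) : ℝ :=
  (1 / (2 * Real.pi)) *
    ∫ θ in (0 : ℝ)..(2 * Real.pi), ∑' k, ‖Polynomial.aeval (circlePoint θ) (p k)‖ ^ 2

/-- `K₀ = Γ(1/4) Γ(5/4) / √π`. -/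
noncomputable def kZero : ℝ := Real.Gamma (1 / 4) * Real.Gamma (5 / 4) / Real.sqrt Real.pi

/-- The general term of the double series for `ρ₀`. -/
noncomputable def rhoTerm (m n : ℕ) : ℝ :=
  (kZero / 2) ^ (2 * m + 2 * n) /
    ((2 * m + 1) * (2 * n + 1) * m.factorial * n.factorial * (m + n).factorial)

/-!
The polynomials of the symmetrized problem satisfy a three-term recurrence whose coefficients are
the square roots of the birth and death rates. Splitting them by parity, and normalizing suitably,
turns the recurrence into the first-order system of `stringPoly`,
`x_{m+1} = x_m - e_m X y_m`, `y_{m+1} = y_m + a_{m+1} X x_{m+1}`. Orthogonality for the moments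
`((-Q)^n)_{00}` is the Karlin-McGregor formula (`momentLin_stringPoly_fst`,
`stringPoly_orthogonal`), and uniqueness of orthonormal polynomials makes `quarticPoly` the only
sequence to be considered.

For the quartic rates `∑ a_m` and `∑ e_m` converge. Hence `x_m(z)` and `y_m(z)` converge for every
complex `z`, their limits are `-B(z)` and `D(z)` (`tendsto_evenVal`, `tendsto_oddVal`), and the
Christoffel-Darboux formula passes to the limit (`christoffel_darboux`).

The limits are found from the generating function `H(s)` of the rotated polynomials. It solves
`(1 - s⁴) H'' - 2 s³ H' = κ² H` with `κ² = i z`, that is, `H'' = κ² H` with respect to the elliptic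
variable `∫_0^s dx / √(1 - x⁴)`. So `√(1 - s⁴) H'(s)` is a hyperbolic cosine of the elliptic
integral (`sqrt_mul_genFun_deriv`). As `s → 1` its left-hand side tends to a combination of the two
limits, by an Abelian theorem for the coefficients of `(1 - s⁴)^(-1/2)` (`tendsto_abel_mean`) and
Wallis' formula, and its right-hand side is evaluated at the complete elliptic integral, a Beta
integral equal to `K₀ / √2` (`integral_one_div_sqrt_quartic`, `beta_eq_kZero`). This gives, with
`t = ω K₀ / 2`, `B(ω²) = -cosh t cos t` and `D(ω²) = (4/π) sinh t sin t`
(`lim_closed_form_kZero`), and addition theorems give the closed form on the unit circle.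

The double series is the termwise integral of the expansion of the closed form in powers of
`cos(θ/2)` and `sin(θ/2)` (`hasSum_kernelTerm`, `trigIntegral_eq`).
-/

open Polynomial

/-! ### The moment functional -/

/-- `momentFunctional s` as a linear map. -/
noncomputable def momentLin (s : ℕ → ℝ) : ℝ[X] →ₗ[ℝ] ℝ :=
  Polynomial.lsum fun j => LinearMap.mulRight ℝ (s j)

lemma momentLin_apply (s : ℕ → ℝ) (f : ℝ[X]) : momentLin s f = momentFunctional s f := rfl

lemma momentLin_monomial (s : ℕ → ℝ) (n : ℕ) (r : ℝ) : momentLin s (monomial n r) = r * s n := by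
  rw [momentLin_apply, momentFunctional, sum_monomial_index]
  simp

lemma momentLin_X_pow (s : ℕ → ℝ) (n : ℕ) : momentLin s (X ^ n) = s n := by
  rw [X_pow_eq_monomial, momentLin_monomial, one_mul]

lemma momentLin_C_mul (s : ℕ → ℝ) (r : ℝ) (f : ℝ[X]) :
    momentLin s (C r * f) = r * momentLin s f := by
  rw [C_mul', map_smul, smul_eq_mul]

/-- If the odd moments vanish, then so does the moment functional on odd polynomials. -/
lemma momentLin_eq_zero_of_odd {s : ℕ → ℝ} (hs : ∀ n, Odd n → s n = 0) {f : ℝ[X]}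
    (hf : f.comp (-X) = -f) : momentLin s f = 0 := by
  have key : ∀ g : ℝ[X], momentLin s (g.comp (-X)) = momentLin s g := by
    intro g
    induction g using Polynomial.induction_on' with
    | add p q hp hq => rw [add_comp, map_add, map_add, hp, hq]
    | monomial n r =>
      have h1 : (monomial n r : ℝ[X]).comp (-X) = monomial n (r * (-1) ^ n) := by
        rw [monomial_comp, neg_pow, ← C_mul_X_pow_eq_monomial, C_mul, C_pow, C_neg, C_1]
        ring
      rw [h1, momentLin_monomial, momentLin_monomial]
      rcases Nat.even_or_odd n with h | h
      · rw [h.neg_one_pow, mul_one]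
      · rw [hs n h, mul_zero, mul_zero]
  have := key f
  rw [hf, map_neg] at this
  linarith

/-- The value at `0` of the polynomial of the second kind is the moment functional applied to
`(f(y) - f(0)) / y`. -/
lemma secondKind_eval_zero (s : ℕ → ℝ) (f : ℝ[X]) :
    (secondKind s f).eval 0 = momentLin s f.divX := by
  let T : ℝ[X] →ₗ[ℝ] ℝ :=
    Polynomial.lsum fun j => LinearMap.mulRight ℝ (if j = 0 then 0 else s (j - 1))
  have h1 : (secondKind s f).eval 0 = T f := by
    have hT : T f = f.sum fun j r => r * (if j = 0 then 0 else s (j - 1)) := rfl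
    rw [hT, secondKind, Polynomial.sum_def, Polynomial.sum_def, eval_finsetSum]
    refine Finset.sum_congr rfl fun j _ => ?_
    rw [eval_finsetSum]
    cases j with
    | zero => simp
    | succ j =>
      rw [Finset.sum_range_succ']
      simp [eval_monomial]
  rw [h1]
  clear h1
  induction f using Polynomial.induction_on' with
  | add p q hp hq => rw [map_add, hp, hq, divX_add, map_add]
  | monomial n r =>
    have hT : T (monomial n r) = r * (if n = 0 then 0 else s (n - 1)) := by
      change (monomial n r : ℝ[X]).sum (fun j r => r * (if j = 0 then 0 else s (j - 1))) = _
      rw [sum_monomial_index]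
      simp
    rw [hT, ← C_mul_X_pow_eq_monomial, divX_C_mul_X_pow]
    split_ifs with h
    · simp
    · rw [momentLin_C_mul, momentLin_X_pow]

/-! ### Uniqueness of orthonormal polynomials -/

/-- The polynomials of a sequence with exact degrees `0, 1, …, n - 1` span those of degree less
than `n`. -/
lemma exists_eq_sum_of_degree_lt {P : ℕ → ℝ[X]} (hdeg : ∀ n, (P n).natDegree = n)
    (hlc : ∀ n, 0 < (P n).leadingCoeff) (n : ℕ) (f : ℝ[X]) (hf : f.degree < n) :
    ∃ b : ℕ → ℝ, f = ∑ k ∈ Finset.range n, C (b k) * P k := by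
  induction n generalizing f with
  | zero =>
    refine ⟨0, ?_⟩
    simpa using hf
  | succ n ih =>
    have hPn : (P n).coeff n ≠ 0 := by
      have := hlc n
      rw [leadingCoeff, hdeg] at this
      exact this.ne'
    set r := f.coeff n / (P n).coeff n with hr
    have hlt : (f - C r * P n).degree < n := by
      rw [degree_lt_iff_coeff_zero]
      intro m hm
      rcases hm.eq_or_lt with rfl | hm
      · rw [coeff_sub, coeff_C_mul, hr, div_mul_cancel₀ _ hPn, sub_self]
      · rw [coeff_sub, coeff_C_mul, 
          coeff_eq_zero_of_natDegree_lt (p := P n) (by rw [hdeg]; exact hm),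
          (degree_lt_iff_coeff_zero f (n + 1)).1 hf m hm]
        simp
    obtain ⟨b, hb⟩ := ih _ hlt
    refine ⟨fun k => if k = n then r else b k, ?_⟩
    simp only [Finset.sum_range_succ, ↓reduceIte]
    rw [← sub_eq_iff_eq_add, hb]
    refine Finset.sum_congr rfl fun k hk => ?_
    rw [if_neg (Finset.mem_range.1 hk).ne]

/-- A moment sequence has at most one sequence of orthonormal polynomials. -/
lemma IsOrthonormalPolys.unique {s : ℕ → ℝ} {p P : ℕ → ℝ[X]} (hp : IsOrthonormalPolys s p)
    (hP : IsOrthonormalPolys s P) : p = P := by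
  have hop : ∀ m n, momentLin s (p m * p n) = if m = n then 1 else 0 := hp.orthonormal
  have hoP : ∀ m n, momentLin s (P m * P n) = if m = n then 1 else 0 := hP.orthonormal
  funext n
  induction n using Nat.strong_induction_on with
  | _ n ih =>
    have hpn := hp.leadingCoeff_pos n
    have hPn := hP.leadingCoeff_pos n
    rw [leadingCoeff, hp.natDegree_eq] at hpn
    rw [leadingCoeff, hP.natDegree_eq] at hPn
    set r := (p n).coeff n / (P n).coeff n with hr
    have hrpos : 0 < r := div_pos hpn hPn
    have hlt : (p n - C r * P n).degree < n := by
      rw [degree_lt_iff_coeff_zero]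
      intro m hm
      rcases hm.eq_or_lt with rfl | hm
      · rw [coeff_sub, coeff_C_mul, hr, div_mul_cancel₀ _ hPn.ne', sub_self]
      · rw [coeff_sub, coeff_C_mul,
          coeff_eq_zero_of_natDegree_lt (p := P n) (by rw [hP.natDegree_eq]; exact hm),
          coeff_eq_zero_of_natDegree_lt (p := p n) (by rw [hp.natDegree_eq]; exact hm)]
        simp
    obtain ⟨b, hb⟩ := exists_eq_sum_of_degree_lt hP.natDegree_eq hP.leadingCoeff_pos n _ hlt
    -- `p n` and `P n` are both orthogonal to the earlier polynomials, on which `p` and `P` agree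
    have hb0 : ∀ k < n, b k = 0 := by
      intro k hk
      have h1 : momentLin s ((p n - C r * P n) * P k) = 0 := by
        rw [sub_mul, map_sub, mul_assoc, momentLin_C_mul, hoP, if_neg hk.ne', ← ih k hk, hop,
          if_neg hk.ne']
        simp
      rw [hb, Finset.sum_mul, map_sum] at h1
      simp only [mul_assoc, momentLin_C_mul, hoP] at h1
      simpa [hk] using h1
    have hpP : p n = C r * P n := by
      rw [← sub_eq_zero, hb]
      refine Finset.sum_eq_zero fun k hk => ?_
      rw [hb0 k (Finset.mem_range.1 hk), C_0, zero_mul]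
    have h1 : r * (r * 1) = 1 := by
      have := hop n n
      rw [if_pos rfl, hpP, mul_assoc, momentLin_C_mul, mul_left_comm, momentLin_C_mul, hoP,
        if_pos rfl] at this
      exact this
    have hr1 : r = 1 := by nlinarith
    rw [hpP, hr1, C_1, one_mul]

/-! ### Symmetrized birth and death polynomials -/

/-- For weights `a`, `e` (the lengths and masses of a Krein string), the pair of polynomials
`(x_m, y_m)` given by `x_0 = 1`, `y_0 = a_0 X`,
`x_{m+1} = x_m - e_m X y_m` and `y_{m+1} = y_m + a_{m+1} X x_{m+1}`. Up to normalization, the `x_m`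
and the `y_m` are the orthogonal polynomials of even and of odd degree of the symmetrized problem
for the birth rates `1 / (a_m e_m)` and the death rates `1 / (a_{m+1} e_m)`. -/
noncomputable def stringPoly (a e : ℕ → ℝ) : ℕ → ℝ[X] × ℝ[X]
  | 0 => (1, C (a 0) * X)
  | m + 1 =>
    ((stringPoly a e m).1 - C (e m) * (X * (stringPoly a e m).2),
      (stringPoly a e m).2 + C (a (m + 1)) *
        (X * ((stringPoly a e m).1 - C (e m) * (X * (stringPoly a e m).2))))

section StringPoly

variable {a e : ℕ → ℝ} {s : ℕ → ℝ}

lemma stringPoly_succ_fst (m : ℕ) : (stringPoly a e (m + 1)).1 =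
    (stringPoly a e m).1 - C (e m) * (X * (stringPoly a e m).2) := rfl

lemma stringPoly_succ_snd (m : ℕ) : (stringPoly a e (m + 1)).2 =
    (stringPoly a e m).2 + C (a (m + 1)) * (X * (stringPoly a e (m + 1)).1) := rfl

lemma stringPoly_parity (m : ℕ) : (stringPoly a e m).1.comp (-X) = (stringPoly a e m).1 ∧
    (stringPoly a e m).2.comp (-X) = -(stringPoly a e m).2 := by
  induction m with
  | zero => simp [stringPoly]
  | succ m ih =>
    have h1 : (stringPoly a e (m + 1)).1.comp (-X) = (stringPoly a e (m + 1)).1 := by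
      rw [stringPoly_succ_fst, sub_comp, mul_comp, mul_comp, C_comp, X_comp, ih.1, ih.2]
      ring
    refine ⟨h1, ?_⟩
    rw [stringPoly_succ_snd, add_comp, mul_comp, mul_comp, C_comp, X_comp, h1, ih.2]
    ring

lemma stringPoly_degree (ha : ∀ m, 0 < a m) (he : ∀ m, 0 < e m) (m : ℕ) :
    ((stringPoly a e m).1.natDegree ≤ 2 * m ∧ 0 < (-1) ^ m * (stringPoly a e m).1.coeff (2 * m)) ∧
    ((stringPoly a e m).2.natDegree ≤ 2 * m + 1 ∧
      0 < (-1) ^ m * (stringPoly a e m).2.coeff (2 * m + 1)) := by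
  induction m with
  | zero =>
    simp only [stringPoly]
    refine ⟨⟨by simp, by simp⟩, (natDegree_C_mul_le _ _).trans natDegree_X_le, ?_⟩
    simpa using ha 0
  | succ m ih =>
    obtain ⟨⟨hx, -⟩, hy, hy'⟩ := ih
    have h1 : (stringPoly a e (m + 1)).1.natDegree ≤ 2 * (m + 1) := by
      rw [stringPoly_succ_fst]
      refine (natDegree_sub_le _ _).trans (max_le (by omega) ?_)
      refine (natDegree_C_mul_le _ _).trans (natDegree_mul_le.trans ?_)
      have := natDegree_X_le (R := ℝ)
      omega
    have h1' : 0 < (-1) ^ (m + 1) * (stringPoly a e (m + 1)).1.coeff (2 * (m + 1)) := by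
      rw [stringPoly_succ_fst, coeff_sub, coeff_C_mul,
        show 2 * (m + 1) = (2 * m + 1) + 1 by ring, coeff_X_mul,
        coeff_eq_zero_of_natDegree_lt (p := (stringPoly a e m).1) (by omega)]
      have := mul_pos (he m) hy'
      rw [pow_succ]
      linarith
    refine ⟨⟨h1, h1'⟩, ?_, ?_⟩
    · rw [stringPoly_succ_snd]
      refine (natDegree_add_le _ _).trans (max_le (by omega) ?_)
      refine (natDegree_C_mul_le _ _).trans (natDegree_mul_le.trans ?_)
      have := natDegree_X_le (R := ℝ)
      omega
    · rw [stringPoly_succ_snd, coeff_add, coeff_C_mul, coeff_X_mul,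
        coeff_eq_zero_of_natDegree_lt (p := (stringPoly a e m).2) (by omega)]
      have := mul_pos (ha (m + 1)) h1'
      linarith

/-- The birth and death recurrence: `X² x_m` is minus the generator applied to `x`. -/
lemma X_sq_mul_stringPoly_fst {lam mu : ℕ → ℝ} (hlam : ∀ m, lam m * (a m * e m) = 1)
    (hmu : ∀ m, mu (m + 1) * (a (m + 1) * e m) = 1) (hmu0 : mu 0 = 0) (m : ℕ) :
    X ^ 2 * (stringPoly a e m).1 = C (lam m + mu m) * (stringPoly a e m).1 -
      C (lam m) * (stringPoly a e (m + 1)).1 - C (mu m) * (stringPoly a e (m - 1)).1 := by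
  have hl : C (lam m) * (C (a m) * C (e m)) = (1 : ℝ[X]) := by
    rw [← C_mul, ← C_mul, hlam, C_1]
  cases m with
  | zero =>
    have h0 : (stringPoly a e 0).2 = C (a 0) * (X * (stringPoly a e 0).1) := by simp [stringPoly]
    rw [hmu0, stringPoly_succ_fst, h0]
    simp only [add_zero, C_0, zero_mul]
    linear_combination (-X ^ 2 * (stringPoly a e 0).1) * hl
  | succ m =>
    rw [stringPoly_succ_fst (m + 1), Nat.add_sub_cancel]
    have h1 := stringPoly_succ_fst (a := a) (e := e) m
    have h2 := stringPoly_succ_snd (a := a) (e := e) m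
    set x := (stringPoly a e m).1
    set y := (stringPoly a e m).2
    set x' := (stringPoly a e (m + 1)).1
    set y' := (stringPoly a e (m + 1)).2
    -- both products equal `1 / a_{m+1}`
    have hle : C (lam (m + 1)) * C (e (m + 1)) = (C (mu (m + 1)) * C (e m) : ℝ[X]) := by
      rw [← C_mul, ← C_mul]
      congr 1
      have := hlam (m + 1)
      have h' := hmu m
      have ha : a (m + 1) ≠ 0 := by rintro h; simp [h] at h'
      apply mul_left_cancel₀ ha
      linarith
    rw [C_add]
    linear_combination (-C (mu (m + 1))) * h1 - X ^ 2 * x' * hl - X * y * hle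
      - (C (lam (m + 1)) * C (e (m + 1)) * X) * h2

/-- Karlin and McGregor's formula at time zero: `x_m` is orthogonal to `1` for the symmetrized
moments of the birth and death process. -/
lemma momentLin_stringPoly_fst {lam mu : ℕ → ℝ} (hlam : ∀ m, lam m * (a m * e m) = 1)
    (hmu : ∀ m, mu (m + 1) * (a (m + 1) * e m) = 1) (hmu0 : mu 0 = 0) (m : ℕ) :
    momentLin (symmetrizedMoment (birthDeathMoment lam mu)) (stringPoly a e m).1 =
      if m = 0 then 1 else 0 := by
  set L := momentLin (symmetrizedMoment (birthDeathMoment lam mu))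
  -- both sides satisfy the same recurrence in `m`, which raises `n` by one
  have key : ∀ m n, L (X ^ (2 * n) * (stringPoly a e m).1) =
      (negGenerator lam mu)^[n] (Pi.single 0 1) m := by
    intro m
    induction m using Nat.strong_induction_on with
    | _ m ih =>
      intro n
      cases m with
      | zero =>
        have h0 : (stringPoly a e 0).1 = 1 := rfl
        rw [h0, mul_one, momentLin_X_pow, symmetrizedMoment, if_pos (even_two_mul n),
          Nat.mul_div_cancel_left n two_pos, birthDeathMoment]
      | succ m =>
        have hrec := congrArg (fun f => L (X ^ (2 * n) * f))
          (X_sq_mul_stringPoly_fst (a := a) (e := e) hlam hmu hmu0 m)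
        have e1 : (X ^ (2 * n) * (X ^ 2 * (stringPoly a e m).1) : ℝ[X]) =
          X ^ (2 * (n + 1)) * (stringPoly a e m).1 := by ring
        simp only [mul_sub, mul_left_comm (X ^ (2 * n)) (C _), map_sub, e1] at hrec
        rw [momentLin_C_mul, momentLin_C_mul, momentLin_C_mul, ih m (by omega), ih m (by omega),
          ih (m - 1) (by omega), Function.iterate_succ_apply'] at hrec
        set v := (negGenerator lam mu)^[n] (Pi.single 0 1)
        rw [negGenerator] at hrec
        have hl : lam m ≠ 0 := by
          intro h
          have := hlam m
          simp [h] at this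
        apply mul_left_cancel₀ hl
        linarith
  have := key m 0
  rw [mul_zero, pow_zero, one_mul] at this
  rw [this, Function.iterate_zero_apply, Pi.single_apply]

lemma symmetrizedMoment_of_odd (s : ℕ → ℝ) (n : ℕ) (hn : Odd n) : symmetrizedMoment s n = 0 := by
  rw [symmetrizedMoment, if_neg (Nat.not_even_iff_odd.2 hn)]

/-- Orthogonality among the `x_m` and among the `y_m`. It spreads from `x_0 = 1` because
`X y_m` is a multiple of `x_m - x_{m+1}` and `X x_m` is a multiple of `y_m - y_{m-1}`. -/
lemma stringPoly_orthogonal (ha : ∀ m, 0 < a m) (he : ∀ m, 0 < e m) (ha0 : a 0 = 1)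
    (hL : ∀ m, momentLin s (stringPoly a e m).1 = if m = 0 then 1 else 0) (m n : ℕ) :
    momentLin s ((stringPoly a e m).1 * (stringPoly a e n).1) = (if m = n then (a m)⁻¹ else 0) ∧
    momentLin s ((stringPoly a e m).2 * (stringPoly a e n).2) = (if m = n then (e m)⁻¹ else 0) := by
  set x := fun m => (stringPoly a e m).1 with hx
  set y := fun m => (stringPoly a e m).2 with hy
  set L := momentLin s
  change L (x m * x n) = _ ∧ L (y m * y n) = _
  have hx0 : x 0 = 1 := rfl
  have hy0 : y 0 = C (a 0) * (X * x 0) := by simp [hx, hy, stringPoly]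
  have hxs : ∀ m, x (m + 1) = x m - C (e m) * (X * y m) := stringPoly_succ_fst
  have hys : ∀ m, y (m + 1) = y m + C (a (m + 1)) * (X * x (m + 1)) := stringPoly_succ_snd
  -- pairing with `X y_n`, rewritten through the `x`
  have hXy : ∀ f n, e n * L (X * f * y n) = L (f * x n) - L (f * x (n + 1)) := by
    intro f n
    rw [hxs, mul_sub, map_sub, ← momentLin_C_mul, sub_sub_cancel]
    congr 1; ring
  have hXx0 : ∀ f, a 0 * L (X * f * x 0) = L (f * y 0) := by
    intro f
    rw [hy0, ← momentLin_C_mul]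
    congr 1; ring
  have hXx : ∀ f n, a (n + 1) * L (X * f * x (n + 1)) = L (f * y (n + 1)) - L (f * y n) := by
    intro f n
    rw [hys n, mul_add, map_add, ← momentLin_C_mul, add_sub_cancel_left]
    congr 1; ring
  induction m generalizing n with
  | zero =>
    have h1 : ∀ n, L (x 0 * x n) = if 0 = n then (a 0)⁻¹ else 0 := by
      intro n
      rw [hx0, one_mul, ha0, inv_one]
      simpa [eq_comm] using hL n
    refine ⟨h1 n, ?_⟩
    have h2 := hXy (x 0) n
    have h3 : L (y 0 * y n) = a 0 * L (X * x 0 * y n) := by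
      rw [hy0, ← momentLin_C_mul]; congr 1; ring
    rw [h1, h1, if_neg (Nat.succ_ne_zero n).symm, sub_zero, ha0] at h2
    rw [h3, ha0, one_mul]
    apply mul_left_cancel₀ (he n).ne'
    rw [h2]
    split_ifs with h
    · subst h
      rw [mul_inv_cancel₀ (he 0).ne', inv_one]
    · simp
  | succ m ih =>
    have h1 : ∀ n, L (x (m + 1) * x n) = if m + 1 = n then (a (m + 1))⁻¹ else 0 := by
      intro n
      have h2 : L (x (m + 1) * x n) = L (x m * x n) - e m * L (X * y m * x n) := by
        rw [hxs, sub_mul, map_sub, ← momentLin_C_mul]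
        congr 2; ring
      rw [h2, (ih n).1]
      have han := (ha n).ne'
      have hem := (he m).ne'
      cases n with
      | zero =>
        have h3 := hXx0 (y m)
        rw [(ih 0).2, ha0, one_mul] at h3
        rw [h3]
        rw [if_neg (Nat.succ_ne_zero m)]
        by_cases h4 : m = 0
        · subst h4
          rw [if_pos rfl, if_pos rfl, ha0, mul_inv_cancel₀ (he 0).ne', inv_one, sub_self]
        · rw [if_neg h4, if_neg h4, mul_zero, sub_zero]
      | succ n =>
        have h3 := hXx (y m) n
        rw [(ih n).2, (ih (n + 1)).2] at h3
        have h4 : L (X * y m * x (n + 1)) =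
            (a (n + 1))⁻¹ * (a (n + 1) * L (X * y m * x (n + 1))) := by
          rw [inv_mul_cancel_left₀ han]
        rw [h4, h3]
        by_cases c1 : m = n + 1
        · subst c1
          rw [if_pos rfl, if_pos rfl, if_neg (by omega), if_neg (by omega)]
          field_simp
          ring
        · by_cases c2 : m = n
          · subst c2
            rw [if_neg c1, if_neg c1, if_pos rfl, if_pos rfl]
            field_simp
            ring
          · rw [if_neg c1, if_neg c1, if_neg c2, if_neg (by omega)]
            ring
    refine ⟨h1 n, ?_⟩
    have h2 : L (y (m + 1) * y n) = L (y m * y n) + a (m + 1) * L (X * x (m + 1) * y n) := by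
      rw [hys, add_mul, map_add, ← momentLin_C_mul]
      congr 2; ring
    have h3 := hXy (x (m + 1)) n
    rw [h1, h1] at h3
    have ham := (ha (m + 1)).ne'
    have hen := (he n).ne'
    have h4 : L (X * x (m + 1) * y n) = (e n)⁻¹ * (e n * L (X * x (m + 1) * y n)) := by
      rw [inv_mul_cancel_left₀ hen]
    rw [h2, (ih n).2, h4, h3]
    by_cases c1 : m = n
    · subst c1
      rw [if_pos rfl, if_neg (by omega), if_pos rfl, if_neg (by omega)]
      field_simp
      ring
    · by_cases c2 : m + 1 = n
      · subst c2
        rw [if_neg c1, if_pos rfl, if_neg (by omega), if_pos rfl]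
        field_simp
        ring
      · rw [if_neg c1, if_neg c2, if_neg (by omega), if_neg c2]
        ring

/-- The orthonormal polynomials, obtained by normalizing the `x_m` and the `y_m`. -/
noncomputable def stringOrthonormal (a e : ℕ → ℝ) (n : ℕ) : ℝ[X] :=
  if Even n then C ((-1) ^ (n / 2) * √(a (n / 2))) * (stringPoly a e (n / 2)).1
  else C ((-1) ^ (n / 2) * √(e (n / 2))) * (stringPoly a e (n / 2)).2

lemma stringOrthonormal_even (m : ℕ) : stringOrthonormal a e (2 * m) =
    C ((-1) ^ m * √(a m)) * (stringPoly a e m).1 := by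
  rw [stringOrthonormal, if_pos (even_two_mul m), Nat.mul_div_cancel_left m two_pos]

lemma stringOrthonormal_odd (m : ℕ) : stringOrthonormal a e (2 * m + 1) =
    C ((-1) ^ m * √(e m)) * (stringPoly a e m).2 := by
  rw [stringOrthonormal, if_neg (by simp), show (2 * m + 1) / 2 = m by omega]

lemma isOrthonormalPolys_stringOrthonormal (ha : ∀ m, 0 < a m) (he : ∀ m, 0 < e m) (ha0 : a 0 = 1)
    (hodd : ∀ n, Odd n → s n = 0)
    (hL : ∀ m, momentLin s (stringPoly a e m).1 = if m = 0 then 1 else 0) :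
    IsOrthonormalPolys s (stringOrthonormal a e) := by
  have hdeg : ∀ n, (stringOrthonormal a e n).natDegree ≤ n ∧
      0 < (stringOrthonormal a e n).coeff n := by
    intro n
    obtain ⟨m, rfl | rfl⟩ := Nat.even_or_odd' n
    · rw [stringOrthonormal_even]
      have h := (stringPoly_degree ha he m).1
      refine ⟨(natDegree_C_mul_le _ _).trans h.1, ?_⟩
      rw [coeff_C_mul]
      have := mul_pos (Real.sqrt_pos.2 (ha m)) h.2
      linarith
    · rw [stringOrthonormal_odd]
      have h := (stringPoly_degree ha he m).2
      refine ⟨(natDegree_C_mul_le _ _).trans h.1, ?_⟩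
      rw [coeff_C_mul]
      have := mul_pos (Real.sqrt_pos.2 (he m)) h.2
      linarith
  have hnd : ∀ n, (stringOrthonormal a e n).natDegree = n := fun n =>
    le_antisymm (hdeg n).1 (le_natDegree_of_ne_zero (hdeg n).2.ne')
  have hxy : ∀ m n, momentLin s ((stringPoly a e m).1 * (stringPoly a e n).2) = 0 := fun m n =>
    momentLin_eq_zero_of_odd hodd (by
      rw [mul_comp, (stringPoly_parity m).1, (stringPoly_parity n).2, mul_neg])
  have hC : ∀ (r t : ℝ) (f g : ℝ[X]),
      momentLin s ((C r * f) * (C t * g)) = r * t * momentLin s (f * g) := by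
    intro r t f g
    rw [← momentLin_C_mul, C_mul]
    congr 1; ring
  refine ⟨hnd, fun n => ?_, fun k l => ?_⟩
  · rw [leadingCoeff, hnd]
    exact (hdeg n).2
  · rw [← momentLin_apply]
    have hsq : ∀ (m : ℕ) (r : ℝ), 0 < r →
        (-1) ^ m * √r * ((-1) ^ m * √r) * r⁻¹ = 1 := by
      intro m r hr
      have h1 : ((-1 : ℝ) ^ m) * (-1) ^ m = 1 := by
        rw [← mul_pow]; norm_num
      calc (-1 : ℝ) ^ m * √r * ((-1) ^ m * √r) * r⁻¹
          = ((-1) ^ m * (-1) ^ m) * (√r * √r) * r⁻¹ := by ring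
        _ = 1 := by rw [h1, Real.mul_self_sqrt hr.le, one_mul, mul_inv_cancel₀ hr.ne']
    obtain ⟨m, rfl | rfl⟩ := Nat.even_or_odd' k <;> obtain ⟨n, rfl | rfl⟩ := Nat.even_or_odd' l
    · rw [stringOrthonormal_even, stringOrthonormal_even, hC,
        (stringPoly_orthogonal ha he ha0 hL m n).1]
      by_cases h : m = n
      · subst h
        rw [if_pos rfl, if_pos rfl, hsq m _ (ha m)]
      · rw [if_neg h, if_neg (by omega), mul_zero]
    · rw [stringOrthonormal_even, stringOrthonormal_odd, hC, hxy, if_neg (by omega), mul_zero]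
    · rw [stringOrthonormal_even, stringOrthonormal_odd, hC, mul_comm (stringPoly a e m).2, hxy,
        if_neg (by omega), mul_zero]
    · rw [stringOrthonormal_odd, stringOrthonormal_odd, hC,
        (stringPoly_orthogonal ha he ha0 hL m n).2]
      by_cases h : m = n
      · subst h
        rw [if_pos rfl, if_pos rfl, hsq m _ (he m)]
      · rw [if_neg h, if_neg (by omega), mul_zero]

/-- The values at `0` of the polynomials of the second kind of `x_m` and `y_m`. -/
lemma momentLin_divX_stringPoly (ha0 : a 0 = 1) (hodd : ∀ n, Odd n → s n = 0)
    (hL : ∀ m, momentLin s (stringPoly a e m).1 = if m = 0 then 1 else 0) (m : ℕ) :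
    momentLin s (stringPoly a e m).1.divX = 0 ∧ momentLin s (stringPoly a e m).2.divX = 1 := by
  have hsub : ∀ (f g : ℝ[X]) (r : ℝ), (f + C r * (X * g)).divX = f.divX + C r * g := by
    intro f g r
    rw [divX_add, divX_C_mul]
    congr 2
    ext n
    rw [coeff_divX, coeff_X_mul]
  induction m with
  | zero =>
    have h0 : (stringPoly a e 0).2 = 0 + C (a 0) * (X * (stringPoly a e 0).1) := by
      simp [stringPoly]
    have h1 : (stringPoly a e 0).1.divX = 0 := divX_one
    rw [h0, hsub, h1, divX_zero, zero_add, momentLin_C_mul, hL]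
    simp [ha0]
  | succ m ih =>
    have h1 : (stringPoly a e (m + 1)).1 =
        (stringPoly a e m).1 + C (-e m) * (X * (stringPoly a e m).2) := by
      rw [stringPoly_succ_fst, C_neg]; ring
    constructor
    · rw [h1, hsub, map_add, ih.1, momentLin_C_mul,
        momentLin_eq_zero_of_odd hodd (stringPoly_parity m).2]
      simp
    · rw [stringPoly_succ_snd, hsub, map_add, ih.2, momentLin_C_mul, hL]
      simp

lemma stringPoly_eval_zero (m : ℕ) :
    (stringPoly a e m).1.eval 0 = 1 ∧ (stringPoly a e m).2.eval 0 = 0 := by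
  induction m with
  | zero => simp [stringPoly]
  | succ m ih => simp [stringPoly_succ_fst, stringPoly_succ_snd, ih.1, ih.2]

end StringPoly

/-! ### The weights of the quartic process -/

/-- `c_m = (1/2)_m / m!`, the absolute value of the binomial coefficient `-1/2` over `m`. -/
noncomputable def halfBinom (m : ℕ) : ℝ := m.centralBinom / 4 ^ m

/-- The weights `a_m = c_m² / (4m+1)` of the quartic process. -/
noncomputable def evenWeight (m : ℕ) : ℝ := halfBinom m ^ 2 / (4 * m + 1)

/-- The weights `e_m = 1 / ((4m+2)² (4m+3) c_m²)` of the quartic process. -/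
noncomputable def oddWeight (m : ℕ) : ℝ := 1 / ((4 * m + 2) ^ 2 * (4 * m + 3) * halfBinom m ^ 2)

lemma halfBinom_pos (m : ℕ) : 0 < halfBinom m := by
  have := m.centralBinom_pos
  unfold halfBinom
  positivity

lemma halfBinom_zero : halfBinom 0 = 1 := by simp [halfBinom]

lemma halfBinom_succ (m : ℕ) : halfBinom (m + 1) * (2 * m + 2) = halfBinom m * (2 * m + 1) := by
  have h : ((m : ℝ) + 1) * (m + 1).centralBinom = 2 * (2 * m + 1) * m.centralBinom := by
    exact_mod_cast Nat.succ_mul_centralBinom_succ m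
  unfold halfBinom
  rw [pow_succ]
  field_simp
  linear_combination 2 * h

lemma halfBinom_succ_eq (m : ℕ) : halfBinom (m + 1) = halfBinom m * (2 * m + 1) / (2 * m + 2) := by
  rw [eq_div_iff (by positivity), halfBinom_succ]

lemma halfBinom_sq_le (m : ℕ) : (2 * m + 1) * halfBinom m ^ 2 ≤ 1 := by
  induction m with
  | zero => simp [halfBinom_zero]
  | succ m ih =>
    refine le_trans ?_ ih
    rw [halfBinom_succ_eq]
    push_cast
    rw [div_pow, mul_div_assoc', div_le_iff₀ (by positivity)]
    have : 0 ≤ halfBinom m ^ 2 * (2 * m + 1) := by positivity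
    nlinarith

/-- Together with `halfBinom_sq_le`, this shows that `c_m²` is of the order of `1 / m`. -/
lemma one_le_halfBinom_sq (m : ℕ) : 1 ≤ (4 * m + 1) * halfBinom m ^ 2 := by
  induction m with
  | zero => simp [halfBinom_zero]
  | succ m ih =>
    refine le_trans ih ?_
    rw [halfBinom_succ_eq]
    push_cast
    rw [div_pow, mul_div_assoc', le_div_iff₀ (by positivity)]
    have : 0 ≤ halfBinom m ^ 2 := by positivity
    nlinarith

lemma evenWeight_pos (m : ℕ) : 0 < evenWeight m := by
  have := halfBinom_pos m
  unfold evenWeight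
  positivity

lemma oddWeight_pos (m : ℕ) : 0 < oddWeight m := by
  have := halfBinom_pos m
  unfold oddWeight
  positivity

lemma evenWeight_zero : evenWeight 0 = 1 := by simp [evenWeight, halfBinom_zero]

lemma evenWeight_le (m : ℕ) : evenWeight m ≤ 1 / ((m : ℝ) + 1) ^ 2 := by
  have h := halfBinom_sq_le m
  rw [evenWeight, div_le_div_iff₀ (by positivity) (by positivity)]
  have : 0 ≤ halfBinom m ^ 2 := by positivity
  have hm : (0 : ℝ) ≤ m := m.cast_nonneg
  nlinarith [mul_nonneg this (mul_nonneg hm hm), mul_nonneg this hm, mul_nonneg (sub_nonneg.2 h) hm]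

lemma oddWeight_le (m : ℕ) : oddWeight m ≤ 1 / ((m : ℝ) + 1) ^ 2 := by
  have h := one_le_halfBinom_sq m
  have hm : (0 : ℝ) ≤ m := m.cast_nonneg
  rw [oddWeight]
  apply one_div_le_one_div_of_le (by positivity)
  have h2 : 1 ≤ (4 * m + 3) * halfBinom m ^ 2 := by nlinarith [sq_nonneg (halfBinom m)]
  calc ((m : ℝ) + 1) ^ 2 ≤ (4 * m + 2) ^ 2 * 1 := by nlinarith
    _ ≤ (4 * m + 2) ^ 2 * ((4 * m + 3) * halfBinom m ^ 2) := by gcongr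
    _ = _ := by ring

lemma summable_one_div_succ_sq : Summable fun m : ℕ => 1 / ((m : ℝ) + 1) ^ 2 := by
  have h := (summable_nat_add_iff 1).2 (Real.summable_one_div_nat_pow.2 one_lt_two)
  simpa using h

lemma birthRate_mul (m : ℕ) : birthRate m * (evenWeight m * oddWeight m) = 1 := by
  have := (halfBinom_pos m).ne'
  unfold birthRate evenWeight oddWeight
  field_simp

lemma deathRate_mul (m : ℕ) : deathRate (m + 1) * (evenWeight (m + 1) * oddWeight m) = 1 := by
  have := (halfBinom_pos m).ne'
  unfold deathRate evenWeight oddWeight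
  rw [halfBinom_succ_eq]
  push_cast
  field_simp
  ring

lemma deathRate_zero : deathRate 0 = 0 := by simp [deathRate]

lemma quarticMoment_of_odd (n : ℕ) (hn : Odd n) : quarticMoment n = 0 :=
  symmetrizedMoment_of_odd _ n hn

lemma momentLin_quartic (m : ℕ) :
    momentLin quarticMoment (stringPoly evenWeight oddWeight m).1 = if m = 0 then 1 else 0 :=
  momentLin_stringPoly_fst birthRate_mul deathRate_mul deathRate_zero m

lemma isOrthonormalPolys_quartic :
    IsOrthonormalPolys quarticMoment (stringOrthonormal evenWeight oddWeight) :=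
  isOrthonormalPolys_stringOrthonormal evenWeight_pos oddWeight_pos evenWeight_zero
    quarticMoment_of_odd momentLin_quartic

/-! ### Convergence of the normalized polynomials -/

/-- `x_m(z)`: the orthogonal polynomial of degree `2m`, normalized to be `1` at `0`. -/
noncomputable def evenVal (z : ℂ) (m : ℕ) : ℂ := aeval z (stringPoly evenWeight oddWeight m).1

/-- `y_m(z)`: the orthogonal polynomial of degree `2m+1`, normalized so that its polynomial of the
second kind is `1` at `0`. -/
noncomputable def oddVal (z : ℂ) (m : ℕ) : ℂ := aeval z (stringPoly evenWeight oddWeight m).2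

lemma evenVal_zero_right (z : ℂ) : evenVal z 0 = 1 := by simp [evenVal, stringPoly]

lemma oddVal_zero_right (z : ℂ) : oddVal z 0 = z := by
  simp [oddVal, stringPoly, evenWeight_zero]

lemma evenVal_succ (z : ℂ) (m : ℕ) :
    evenVal z (m + 1) = evenVal z m - z * (oddWeight m * oddVal z m) := by
  rw [evenVal, stringPoly_succ_fst, map_sub, map_mul, map_mul, aeval_C, aeval_X, evenVal, oddVal,
    Complex.coe_algebraMap]
  ring

lemma oddVal_succ (z : ℂ) (m : ℕ) :
    oddVal z (m + 1) = oddVal z m + z * (evenWeight (m + 1) * evenVal z (m + 1)) := by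
  rw [oddVal, stringPoly_succ_snd, map_add, map_mul, map_mul, aeval_C, aeval_X, evenVal, oddVal,
    Complex.coe_algebraMap]
  ring

lemma val_neg (z : ℂ) (m : ℕ) : evenVal (-z) m = evenVal z m ∧ oddVal (-z) m = -oddVal z m := by
  induction m with
  | zero => simp [evenVal_zero_right, oddVal_zero_right]
  | succ m ih =>
    have h1 : evenVal (-z) (m + 1) = evenVal z (m + 1) := by
      rw [evenVal_succ, evenVal_succ, ih.1, ih.2]; ring
    refine ⟨h1, ?_⟩
    rw [oddVal_succ, oddVal_succ, ih.2, h1]; ring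

lemma val_conj (z : ℂ) (m : ℕ) :
    evenVal (starRingEnd ℂ z) m = starRingEnd ℂ (evenVal z m) ∧
      oddVal (starRingEnd ℂ z) m = starRingEnd ℂ (oddVal z m) := by
  induction m with
  | zero => simp [evenVal_zero_right, oddVal_zero_right]
  | succ m ih =>
    have h1 : evenVal (starRingEnd ℂ z) (m + 1) = starRingEnd ℂ (evenVal z (m + 1)) := by
      rw [evenVal_succ, evenVal_succ, ih.1, ih.2]; simp
    refine ⟨h1, ?_⟩
    rw [oddVal_succ, oddVal_succ, ih.2, h1]; simp

/-- The values at a fixed point are bounded, because `∑ a_m` and `∑ e_m` converge. -/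
lemma exists_val_bound (z : ℂ) : ∃ M : ℝ, ∀ m, ‖evenVal z m‖ ≤ M ∧ ‖oddVal z m‖ ≤ M := by
  set t : ℕ → ℝ := fun m => ‖z‖ * (1 / ((m : ℝ) + 1) ^ 2) with ht
  have ht0 : ∀ m, 0 ≤ t m := fun m => by positivity
  have hts : Summable t := summable_one_div_succ_sq.mul_left _
  have hx : ∀ m, ‖evenVal z (m + 1)‖ ≤ ‖evenVal z m‖ + t m * ‖oddVal z m‖ := by
    intro m
    rw [evenVal_succ]
    refine (norm_sub_le _ _).trans ?_
    rw [norm_mul, norm_mul, Complex.norm_real, Real.norm_of_nonneg (oddWeight_pos m).le,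
      ← mul_assoc]
    simp only [ht]
    gcongr
    exact oddWeight_le m
  have hy : ∀ m, ‖oddVal z (m + 1)‖ ≤ ‖oddVal z m‖ + t m * ‖evenVal z (m + 1)‖ := by
    intro m
    rw [oddVal_succ]
    refine (norm_add_le _ _).trans ?_
    rw [norm_mul, norm_mul, Complex.norm_real, Real.norm_of_nonneg (evenWeight_pos _).le,
      ← mul_assoc]
    simp only [ht]
    gcongr
    refine (evenWeight_le _).trans ?_
    push_cast
    gcongr
    linarith
  -- a discrete Gronwall estimate
  have key : ∀ m, ‖evenVal z m‖ + ‖oddVal z m‖ ≤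
      (1 + ‖z‖) * Real.exp (∑ k ∈ Finset.range m, 2 * t k) := by
    intro m
    induction m with
    | zero => simp [evenVal_zero_right, oddVal_zero_right]
    | succ m ih =>
      have hexp : (1 + t m) * (1 + t m) ≤ Real.exp (2 * t m) := by
        have h1 := Real.add_one_le_exp (t m)
        rw [two_mul, Real.exp_add]
        have := ht0 m
        gcongr <;> linarith
      rw [Finset.sum_range_succ, Real.exp_add, ← mul_assoc]
      calc ‖evenVal z (m + 1)‖ + ‖oddVal z (m + 1)‖
          ≤ (‖evenVal z m‖ + ‖oddVal z m‖) * ((1 + t m) * (1 + t m)) := by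
            have h1 := hx m
            have h2 := hy m
            have h3 := mul_le_mul_of_nonneg_left h1 (ht0 m)
            have h4 : 0 ≤ t m * ‖evenVal z m‖ := mul_nonneg (ht0 m) (norm_nonneg _)
            have h5 : 0 ≤ t m * ‖oddVal z m‖ := mul_nonneg (ht0 m) (norm_nonneg _)
            have h6 : 0 ≤ t m * (t m * ‖evenVal z m‖) := mul_nonneg (ht0 m) h4
            nlinarith
        _ ≤ (1 + ‖z‖) * Real.exp (∑ k ∈ Finset.range m, 2 * t k) * Real.exp (2 * t m) := by
            gcongr
  refine ⟨(1 + ‖z‖) * Real.exp (∑' k, 2 * t k), fun m => ?_⟩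
  have h1 : ‖evenVal z m‖ + ‖oddVal z m‖ ≤ (1 + ‖z‖) * Real.exp (∑' k, 2 * t k) := by
    refine (key m).trans ?_
    gcongr
    exact (hts.mul_left 2).sum_le_tsum _ fun k _ => by have := ht0 k; positivity
  constructor <;> linarith [norm_nonneg (evenVal z m), norm_nonneg (oddVal z m)]

lemma summable_evenWeight_mul {f : ℕ → ℂ} {M : ℝ} (hf : ∀ m, ‖f m‖ ≤ M) :
    Summable fun m => (evenWeight m : ℂ) * f m := by
  refine Summable.of_norm_bounded (summable_one_div_succ_sq.mul_right M) fun m => ?_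
  rw [norm_mul, Complex.norm_real, Real.norm_of_nonneg (evenWeight_pos m).le]
  have := evenWeight_le m
  have := hf m
  gcongr

lemma summable_oddWeight_mul {f : ℕ → ℂ} {M : ℝ} (hf : ∀ m, ‖f m‖ ≤ M) :
    Summable fun m => (oddWeight m : ℂ) * f m := by
  refine Summable.of_norm_bounded (summable_one_div_succ_sq.mul_right M) fun m => ?_
  rw [norm_mul, Complex.norm_real, Real.norm_of_nonneg (oddWeight_pos m).le]
  have := oddWeight_le m
  have := hf m
  gcongr

lemma summable_evenVal (z : ℂ) : Summable fun m => (evenWeight m : ℂ) * evenVal z m := by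
  obtain ⟨M, hM⟩ := exists_val_bound z
  exact summable_evenWeight_mul fun m => (hM m).1

lemma summable_oddVal (z : ℂ) : Summable fun m => (oddWeight m : ℂ) * oddVal z m := by
  obtain ⟨M, hM⟩ := exists_val_bound z
  exact summable_oddWeight_mul fun m => (hM m).2

/-- The limit of `x_m(z)`; it is the Nevanlinna function `-B(z)`. -/
noncomputable def evenLim (z : ℂ) : ℂ := 1 - z * ∑' m, (oddWeight m : ℂ) * oddVal z m

/-- The limit of `y_m(z)`; it is the Nevanlinna function `D(z)`. -/
noncomputable def oddLim (z : ℂ) : ℂ := z * ∑' m, (evenWeight m : ℂ) * evenVal z m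

open Filter Topology in
lemma tendsto_evenVal (z : ℂ) : Tendsto (evenVal z) atTop (𝓝 (evenLim z)) := by
  have h : evenVal z = fun m => 1 - z * ∑ k ∈ Finset.range m, (oddWeight k : ℂ) * oddVal z k := by
    funext m
    induction m with
    | zero => simp [evenVal_zero_right]
    | succ m ih => rw [evenVal_succ, ih, Finset.sum_range_succ]; ring
  rw [h]
  exact tendsto_const_nhds.sub ((summable_oddVal z).hasSum.tendsto_sum_nat.const_mul z)

open Filter Topology in
lemma tendsto_oddVal (z : ℂ) : Tendsto (oddVal z) atTop (𝓝 (oddLim z)) := by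
  have h : oddVal z =
      fun m => z * ∑ k ∈ Finset.range (m + 1), (evenWeight k : ℂ) * evenVal z k := by
    funext m
    induction m with
    | zero => simp [evenVal_zero_right, oddVal_zero_right, evenWeight_zero]
    | succ m ih => rw [oddVal_succ, ih, Finset.sum_range_succ _ (m + 1)]; ring
  rw [h]
  exact ((tendsto_add_atTop_iff_nat 1).2
    (summable_evenVal z).hasSum.tendsto_sum_nat).const_mul z

open Filter Topology in
/-- The limit of the Christoffel-Darboux formula. -/
lemma christoffel_darboux (z w : ℂ) :
    (z - w) * (∑' m, (evenWeight m : ℂ) * (evenVal z m * evenVal w m) +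
      ∑' m, (oddWeight m : ℂ) * (oddVal z m * oddVal w m)) =
      oddLim z * evenLim w - evenLim z * oddLim w := by
  obtain ⟨M, hM⟩ := exists_val_bound z
  obtain ⟨N, hN⟩ := exists_val_bound w
  have s1 : Summable fun m => (evenWeight m : ℂ) * (evenVal z m * evenVal w m) :=
    summable_evenWeight_mul (M := M * N) fun m => by
      rw [norm_mul]
      exact mul_le_mul (hM m).1 (hN m).1 (norm_nonneg _) ((norm_nonneg _).trans (hM m).1)
  have s2 : Summable fun m => (oddWeight m : ℂ) * (oddVal z m * oddVal w m) :=
    summable_oddWeight_mul (M := M * N) fun m => by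
      rw [norm_mul]
      exact mul_le_mul (hM m).2 (hN m).2 (norm_nonneg _) ((norm_nonneg _).trans (hM m).2)
  have hfin : ∀ m, (z - w) *
      (∑ k ∈ Finset.range (m + 1), (evenWeight k : ℂ) * (evenVal z k * evenVal w k) +
        ∑ k ∈ Finset.range m, (oddWeight k : ℂ) * (oddVal z k * oddVal w k)) =
      oddVal z m * evenVal w m - evenVal z m * oddVal w m := by
    intro m
    induction m with
    | zero => simp [evenVal_zero_right, oddVal_zero_right, evenWeight_zero]
    | succ m ih =>
      have h1 := evenVal_succ z m
      have h2 := evenVal_succ w m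
      have h3 := oddVal_succ z m
      have h4 := oddVal_succ w m
      rw [Finset.sum_range_succ _ (m + 1), Finset.sum_range_succ (fun k => (oddWeight k : ℂ) * _) m,
        h3, h4]
      linear_combination ih - oddVal z m * h2 + oddVal w m * h1
  have hl := ((((tendsto_add_atTop_iff_nat 1).2 s1.hasSum.tendsto_sum_nat).add
    s2.hasSum.tendsto_sum_nat).const_mul (z - w))
  have hr := ((tendsto_oddVal z).mul (tendsto_evenVal w)).sub
    ((tendsto_evenVal z).mul (tendsto_oddVal w))
  exact tendsto_nhds_unique (hl.congr hfin) hr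

/-! ### The generating function -/

/-- The elliptic integral `∫_0^s dx / √(1 - x⁴)`. -/
noncomputable def quarticArc (s : ℝ) : ℝ := ∫ x in (0 : ℝ)..s, 1 / √(1 - x ^ 4)

lemma one_sub_pow_four_pos {s : ℝ} (hs : |s| < 1) : 0 < 1 - s ^ 4 := by
  have h1 : s ^ 2 < 1 := by rw [sq_lt_one_iff_abs_lt_one]; exact hs
  nlinarith [sq_nonneg s]

lemma hasDerivAt_quarticArc {s : ℝ} (hs0 : 0 ≤ s) (hs : s < 1) :
    HasDerivAt quarticArc (1 / √(1 - s ^ 4)) s := by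
  have hc : ∀ x ∈ Set.Ioo (-1 : ℝ) 1, ContinuousAt (fun x : ℝ => 1 / √(1 - x ^ 4)) x := by
    intro x hx
    have h := one_sub_pow_four_pos (abs_lt.2 hx)
    have h' : √(1 - x ^ 4) ≠ 0 := (Real.sqrt_pos.2 h).ne'
    fun_prop (disch := assumption)
  have hcon : ContinuousOn (fun x : ℝ => 1 / √(1 - x ^ 4)) (Set.Ioo (-1) 1) :=
    fun x hx => (hc x hx).continuousWithinAt
  refine intervalIntegral.integral_hasDerivAt_right ?_ ?_ (hc s ⟨by linarith, hs⟩)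
  · refine (hcon.mono ?_).intervalIntegrable
    rw [Set.uIcc_of_le hs0]
    exact fun x hx => ⟨by linarith [hx.1], by linarith [hx.2]⟩
  · exact hcon.stronglyMeasurableAtFilter isOpen_Ioo s ⟨by linarith, hs⟩

/-- Power series with polynomially bounded coefficients and possibly missing exponents converge
in the unit interval. -/
lemma summable_lacunary {b : ℕ → ℂ} {k : ℕ → ℕ} {M : ℝ} {j : ℕ}
    (hb : ∀ n, ‖b n‖ ≤ M * ((n : ℝ) + 1) ^ j) (hk : ∀ n, n ≤ k n) {r : ℝ} (hr : |r| < 1) :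
    Summable fun n => b n * (r : ℂ) ^ k n := by
  rcases eq_or_ne r 0 with rfl | hr0
  · refine summable_of_ne_finset_zero (s := {0}) fun n hn => ?_
    have : k n ≠ 0 := by
      have := hk n
      simp only [Finset.mem_singleton] at hn
      omega
    simp [this]
  have hrp : 0 < |r| := abs_pos.2 hr0
  have hsum : Summable fun n : ℕ => ((n : ℝ) ^ j) * |r| ^ n :=
    summable_pow_mul_geometric_of_norm_lt_one j (by simpa using hr)
  have hsum' := ((summable_nat_add_iff 1).2 hsum).mul_left (M * |r|⁻¹)
  refine Summable.of_norm_bounded hsum' fun n => ?_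
  rw [norm_mul, norm_pow, Complex.norm_real, Real.norm_eq_abs]
  have hM : 0 ≤ M * ((n : ℝ) + 1) ^ j := (norm_nonneg _).trans (hb n)
  calc ‖b n‖ * |r| ^ k n ≤ (M * ((n : ℝ) + 1) ^ j) * |r| ^ n :=
        mul_le_mul (hb n) (pow_le_pow_of_le_one hrp.le hr.le (hk n)) (by positivity) hM
    _ = M * |r|⁻¹ * (((n + 1 : ℕ) : ℝ) ^ j * |r| ^ (n + 1)) := by
        rw [pow_succ]; push_cast; field_simp

/-- Termwise differentiation of the series of `summable_lacunary`. -/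
lemma hasDerivAt_lacunary {b : ℕ → ℂ} {k : ℕ → ℕ} {M : ℝ} {j : ℕ}
    (hb : ∀ n, ‖b n‖ ≤ M * ((n : ℝ) + 1) ^ j) (hk : ∀ n, n ≤ k n) (hk' : ∀ n, k n ≤ 2 * n + 1)
    {s : ℝ} (hs : |s| < 1) :
    HasDerivAt (fun x : ℝ => ∑' n, b n * (x : ℂ) ^ k n)
      (∑' n, b n * (k n * (s : ℂ) ^ (k n - 1))) s := by
  obtain ⟨r, hsr, hr1⟩ := exists_between hs
  have hr0 : 0 < r := (abs_nonneg s).trans_lt hsr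
  have hsum : Summable fun n : ℕ => ((n : ℝ) ^ (j + 1)) * r ^ n :=
    summable_pow_mul_geometric_of_norm_lt_one (j + 1) (by rwa [Real.norm_of_nonneg hr0.le])
  have hu := ((summable_nat_add_iff 1).2 hsum).mul_left (2 * M * (r ^ 2)⁻¹)
  have hs' : s ∈ Set.Ioo (-r) r := abs_lt.1 hsr
  have hg0 : Summable fun n => b n * (s : ℂ) ^ k n := summable_lacunary hb hk hs
  have hder : ∀ n, ∀ y ∈ Set.Ioo (-r) r, HasDerivAt (fun x : ℝ => b n * (x : ℂ) ^ k n)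
      (b n * (k n * (y : ℂ) ^ (k n - 1))) y := by
    intro n y _
    exact ((hasDerivAt_pow (k n) (y : ℂ)).comp_ofReal).const_mul (b n)
  have hbd : ∀ n, ∀ y ∈ Set.Ioo (-r) r, ‖b n * (k n * (y : ℂ) ^ (k n - 1))‖ ≤
      2 * M * (r ^ 2)⁻¹ * (((n + 1 : ℕ) : ℝ) ^ (j + 1) * r ^ (n + 1)) := by
    intro n y hy
    have hy' : |y| < r := abs_lt.2 hy
    have hM : 0 ≤ M * ((n : ℝ) + 1) ^ j := (norm_nonneg _).trans (hb n)
    rw [norm_mul, norm_mul, norm_pow, Complex.norm_real, Real.norm_eq_abs, Complex.norm_natCast]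
    have h1 : |y| ^ (k n - 1) ≤ r ^ n * r⁻¹ := by
      calc |y| ^ (k n - 1) ≤ r ^ (k n - 1) := by gcongr
        _ ≤ r ^ (n - 1) := pow_le_pow_of_le_one hr0.le hr1.le (Nat.sub_le_sub_right (hk n) 1)
        _ ≤ r ^ n * r⁻¹ := by
          rw [le_mul_inv_iff₀ hr0]
          cases n with
          | zero => simpa using hr1.le
          | succ n => rw [Nat.add_sub_cancel, pow_succ]
    have h2 : (k n : ℝ) ≤ 2 * (n + 1) := by
      have : (k n : ℝ) ≤ ((2 * n + 1 : ℕ) : ℝ) := by exact_mod_cast hk' n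
      push_cast at this
      linarith
    calc ‖b n‖ * (k n * |y| ^ (k n - 1))
        ≤ (M * ((n : ℝ) + 1) ^ j) * ((2 * (n + 1)) * (r ^ n * r⁻¹)) := by
          gcongr
          exact hb n
      _ = 2 * M * (r ^ 2)⁻¹ * (((n + 1 : ℕ) : ℝ) ^ (j + 1) * r ^ (n + 1)) := by
          push_cast; field_simp; ring
  exact hasDerivAt_tsum_of_isPreconnected hu isOpen_Ioo isPreconnected_Ioo hder hbd hs' hg0 hs'

section GeneratingFunction

variable {h : ℕ → ℂ} {M : ℝ} {κ : ℂ}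

/-- The differential equation `(1 - s⁴) H'' - 2 s³ H' = κ² H` of the generating function
`H(s) = ∑ h_n s^(2n+1)`. -/
lemma genFun_ode (hM : ∀ n, ‖h n‖ ≤ M) (h1 : 6 * h 1 = κ ^ 2 * h 0)
    (hrec : ∀ n : ℕ, (2 * n + 4) * (2 * n + 5) * h (n + 2) =
      κ ^ 2 * h (n + 1) + (2 * n + 2) * (2 * n + 1) * h n) {s : ℝ} (hs : |s| < 1) :
    (1 - (s : ℂ) ^ 4) * ∑' n, (2 * n + 1) * h n * ((2 * n : ℕ) * (s : ℂ) ^ (2 * n - 1)) -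
      2 * (s : ℂ) ^ 3 * ∑' n, (2 * n + 1) * h n * (s : ℂ) ^ (2 * n) =
      κ ^ 2 * ∑' n, h n * (s : ℂ) ^ (2 * n + 1) := by
  have nrm : ∀ a : ℕ, ‖(2 * a + 1 : ℂ)‖ = 2 * a + 1 := by
    intro a
    have : (2 * a + 1 : ℂ) = ((2 * a + 1 : ℕ) : ℂ) := by push_cast; ring
    rw [this, Complex.norm_natCast]
    push_cast; ring
  have nrm2 : ∀ a : ℕ, ‖(2 * a + 2 : ℂ)‖ = 2 * a + 2 := by
    intro a
    have : (2 * a + 2 : ℂ) = ((2 * a + 2 : ℕ) : ℂ) := by push_cast; ring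
    rw [this, Complex.norm_natCast]
    push_cast; ring
  have sH : Summable fun n => h n * (s : ℂ) ^ (2 * n + 1) :=
    summable_lacunary (M := M) (j := 0) (by simpa using hM) (fun n => by omega) hs
  have sH1 : Summable fun n : ℕ => (2 * n + 1) * h n * (s : ℂ) ^ (2 * n) := by
    refine summable_lacunary (M := 2 * M) (j := 1) (fun n => ?_) (fun n => by omega) hs
    rw [norm_mul, nrm]
    have := hM n
    calc (2 * (n : ℝ) + 1) * ‖h n‖ ≤ (2 * n + 2) * M := by gcongr; norm_num
      _ = _ := by ring
  have sg : Summable fun n : ℕ => (2 * n + 2) * (2 * n + 1) * h n * (s : ℂ) ^ (2 * n + 3) := by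
    refine summable_lacunary (M := 4 * M) (j := 2) (fun n => ?_) (fun n => by omega) hs
    rw [norm_mul, norm_mul, nrm, nrm2]
    have := hM n
    calc (2 * (n : ℝ) + 2) * (2 * (n : ℝ) + 1) * ‖h n‖ ≤ (2 * n + 2) * (2 * n + 2) * M := by
          gcongr; norm_num
      _ = _ := by ring
  have sH2' : Summable fun n : ℕ =>
      (2 * n + 3) * h (n + 1) * ((2 * n + 2) * (s : ℂ) ^ (2 * n + 1)) := by
    have : Summable fun n : ℕ =>
        ((2 * n + 3) * (2 * n + 2) * h (n + 1)) * (s : ℂ) ^ (2 * n + 1) := by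
      refine summable_lacunary (M := 6 * M) (j := 2) (fun n => ?_) (fun n => by omega) hs
      have e1 : (2 * n + 3 : ℂ) = 2 * ((n + 1 : ℕ) : ℂ) + 1 := by push_cast; ring
      rw [norm_mul, norm_mul, nrm2, e1, nrm]
      have := hM (n + 1)
      push_cast
      calc (2 * ((n : ℝ) + 1) + 1) * (2 * (n : ℝ) + 2) * ‖h (n + 1)‖
          ≤ (3 * (n + 1)) * (2 * n + 2) * M := by
            gcongr; linarith [(n.cast_nonneg : (0 : ℝ) ≤ n)]
        _ = _ := by ring
    refine this.congr fun n => ?_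
    ring
  have sH2 : Summable fun n : ℕ =>
      (2 * n + 1) * h n * ((2 * n : ℕ) * (s : ℂ) ^ (2 * n - 1)) := by
    rw [← summable_nat_add_iff 1]
    refine sH2'.congr fun n => ?_
    rw [show 2 * (n + 1) - 1 = 2 * n + 1 by omega]
    push_cast; ring
  -- `s⁴ H'' + 2 s³ H'` as a single series
  have hg : (s : ℂ) ^ 4 * (∑' n, (2 * n + 1) * h n * ((2 * n : ℕ) * (s : ℂ) ^ (2 * n - 1))) +
      2 * (s : ℂ) ^ 3 * ∑' n, (2 * n + 1) * h n * (s : ℂ) ^ (2 * n) =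
      ∑' n : ℕ, (2 * n + 2) * (2 * n + 1) * h n * (s : ℂ) ^ (2 * n + 3) := by
    rw [← tsum_mul_left, ← tsum_mul_left, ← (sH2.mul_left _).tsum_add (sH1.mul_left _)]
    refine tsum_congr fun n => ?_
    cases n with
    | zero => simp; ring
    | succ n =>
      rw [show 2 * (n + 1) - 1 = 2 * n + 1 by omega]
      push_cast; ring
  have hH2 : ∑' n, (2 * n + 1) * h n * ((2 * n : ℕ) * (s : ℂ) ^ (2 * n - 1)) =
      κ ^ 2 * (∑' n, h n * (s : ℂ) ^ (2 * n + 1)) +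
      ∑' n : ℕ, (2 * n + 2) * (2 * n + 1) * h n * (s : ℂ) ^ (2 * n + 3) := by
    have e1 : ∑' n, (2 * n + 1) * h n * ((2 * n : ℕ) * (s : ℂ) ^ (2 * n - 1)) =
        ∑' n : ℕ, (2 * n + 3) * h (n + 1) * ((2 * n + 2) * (s : ℂ) ^ (2 * n + 1)) := by
      rw [sH2.tsum_eq_zero_add]
      simp only [mul_zero, Nat.cast_zero, zero_mul, zero_add]
      refine tsum_congr fun n => ?_
      rw [show 2 * (n + 1) - 1 = 2 * n + 1 by omega]
      push_cast; ring
    rw [e1, sH2'.tsum_eq_zero_add, sH.tsum_eq_zero_add, mul_add, ← tsum_mul_left, add_assoc,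
      ← (((summable_nat_add_iff 1).2 sH).mul_left _).tsum_add sg]
    congr 1
    · simp only [Nat.cast_zero, mul_zero, zero_add]
      linear_combination (s : ℂ) * h1
    · refine tsum_congr fun n => ?_
      have := hrec n
      push_cast
      linear_combination (s : ℂ) ^ (2 * n + 3) * this
  linear_combination hH2 - hg

/-- The generating function solves a linear equation with constant coefficients in the elliptic
variable `quarticArc s`, hence is a hyperbolic function of it. -/
lemma sqrt_mul_genFun_deriv (hM : ∀ n, ‖h n‖ ≤ M) (h0 : h 0 = 1) (h1 : 6 * h 1 = κ ^ 2 * h 0)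
    (hrec : ∀ n : ℕ, (2 * n + 4) * (2 * n + 5) * h (n + 2) =
      κ ^ 2 * h (n + 1) + (2 * n + 2) * (2 * n + 1) * h n) {s : ℝ} (hs0 : 0 ≤ s) (hs1 : s < 1) :
    (√(1 - s ^ 4) : ℂ) * ∑' n, (2 * n + 1) * h n * (s : ℂ) ^ (2 * n) =
      Complex.cosh (κ * quarticArc s) := by
  set H : ℝ → ℂ := fun s => ∑' n, h n * (s : ℂ) ^ (2 * n + 1) with hH
  set H1 : ℝ → ℂ := fun s => ∑' n, (2 * n + 1) * h n * (s : ℂ) ^ (2 * n) with hH1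
  set H2 : ℝ → ℂ := fun s => ∑' n, (2 * n + 1) * h n * ((2 * n : ℕ) * (s : ℂ) ^ (2 * n - 1))
  have dH : ∀ x : ℝ, |x| < 1 → HasDerivAt H (H1 x) x := by
    intro x hx
    have := hasDerivAt_lacunary (b := h) (k := fun n => 2 * n + 1) (M := M) (j := 0)
      (by simpa using hM) (fun n => by omega) (fun n => le_rfl) hx
    convert this using 1
    refine tsum_congr fun n => ?_
    rw [Nat.add_sub_cancel]
    push_cast; ring
  have dH1 : ∀ x : ℝ, |x| < 1 → HasDerivAt H1 (H2 x) x := by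
    intro x hx
    refine hasDerivAt_lacunary (b := fun n => (2 * n + 1) * h n) (k := fun n => 2 * n) (M := 2 * M)
      (j := 1) (fun n => ?_) (fun n => by omega) (fun n => by omega) hx
    have : (2 * n + 1 : ℂ) = ((2 * n + 1 : ℕ) : ℂ) := by push_cast; ring
    rw [norm_mul, this, Complex.norm_natCast]
    have := hM n
    push_cast
    calc (2 * (n : ℝ) + 1) * ‖h n‖ ≤ (2 * n + 2) * M := by gcongr; norm_num
      _ = _ := by ring
  have ode : ∀ x : ℝ, |x| < 1 → (1 - (x : ℂ) ^ 4) * H2 x - 2 * (x : ℂ) ^ 3 * H1 x = κ ^ 2 * H x :=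
    fun x hx => genFun_ode hM h1 hrec hx
  set S : ℝ → ℂ := fun x => ((√(1 - x ^ 4) : ℝ) : ℂ) with hS
  have Ssq : ∀ x : ℝ, |x| < 1 → S x * S x = 1 - (x : ℂ) ^ 4 := by
    intro x hx
    simp only [hS]
    rw [← Complex.ofReal_mul, Real.mul_self_sqrt (one_sub_pow_four_pos hx).le]
    push_cast; ring
  have Sne : ∀ x : ℝ, |x| < 1 → S x ≠ 0 := fun x hx =>
    Complex.ofReal_ne_zero.2 (Real.sqrt_pos.2 (one_sub_pow_four_pos hx)).ne'
  have dS : ∀ x : ℝ, |x| < 1 → HasDerivAt S (-2 * (x : ℂ) ^ 3 / S x) x := by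
    intro x hx
    have hp := one_sub_pow_four_pos hx
    have h4 : HasDerivAt (fun x : ℝ => 1 - x ^ 4) (-(4 * x ^ 3)) x := by
      simpa using (hasDerivAt_pow 4 x).const_sub 1
    have h5 := (h4.sqrt hp.ne').ofReal_comp
    convert h5 using 1
    simp only [hS]
    push_cast
    have := Sne x hx
    simp only [hS] at this
    field_simp
    ring
  set ℓ : ℝ → ℂ := fun x => κ * (quarticArc x : ℂ) with hℓ
  have dℓ : ∀ x : ℝ, 0 ≤ x → x < 1 → HasDerivAt ℓ (κ / S x) x := by
    intro x hx0 hx1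
    have := (hasDerivAt_quarticArc hx0 hx1).ofReal_comp.const_mul κ
    have hSx : κ / S x = κ * ((1 / √(1 - x ^ 4) : ℝ) : ℂ) := by
      simp only [hS]
      push_cast
      ring
    rw [hSx]
    exact this
  -- the two first integrals of the equation
  set G1 : ℝ → ℂ := fun x => S x * H1 x * Complex.cosh (ℓ x) - κ * H x * Complex.sinh (ℓ x) with hG1
  set G2 : ℝ → ℂ := fun x => S x * H1 x * Complex.sinh (ℓ x) - κ * H x * Complex.cosh (ℓ x) with hG2
  have dG : ∀ x : ℝ, 0 ≤ x → x < 1 → HasDerivAt G1 0 x ∧ HasDerivAt G2 0 x := by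
    intro x hx0 hx1
    have hx : |x| < 1 := by rwa [abs_of_nonneg hx0]
    have hne := Sne x hx
    have hsq := Ssq x hx
    have ho := ode x hx
    have dc := (Complex.hasDerivAt_cosh (ℓ x)).scomp x (dℓ x hx0 hx1)
    have ds := (Complex.hasDerivAt_sinh (ℓ x)).scomp x (dℓ x hx0 hx1)
    have e1 := ((((dS x hx).mul (dH1 x hx)).mul dc).sub (((dH x hx).const_mul κ).mul ds))
    have e2 := ((((dS x hx).mul (dH1 x hx)).mul ds).sub (((dH x hx).const_mul κ).mul dc))
    constructor
    · convert! e1 using 1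
      simp only [Pi.mul_apply, Function.comp_apply, smul_eq_mul]
      field_simp
      linear_combination (-Complex.cosh (ℓ x)) * ho + (-Complex.cosh (ℓ x) * H2 x) * hsq
    · convert! e2 using 1
      simp only [Pi.mul_apply, Function.comp_apply, smul_eq_mul]
      field_simp
      linear_combination (-Complex.sinh (ℓ x)) * ho + (-Complex.sinh (ℓ x) * H2 x) * hsq
  have hconst : ∀ G : ℝ → ℂ, (∀ x : ℝ, 0 ≤ x → x < 1 → HasDerivAt G 0 x) → G s = G 0 := by
    intro G hG
    refine constant_of_has_deriv_right_zero (a := 0) (b := s)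
      (fun x hx => (hG x hx.1 (hx.2.trans_lt hs1)).continuousAt.continuousWithinAt)
      (fun x hx => (hG x hx.1 (hx.2.trans hs1)).hasDerivWithinAt) s ⟨hs0, le_rfl⟩
  have ℓ0 : ℓ 0 = 0 := by simp [hℓ, quarticArc]
  have S0 : S 0 = 1 := by simp [hS]
  have H0 : H 0 = 0 := by simp [hH]
  have H10 : H1 0 = 1 := by
    simp only [hH1]
    rw [tsum_eq_single 0 fun n hn => by simp [hn]]
    simp [h0]
  have g1 := hconst G1 fun x a b => (dG x a b).1
  have g2 := hconst G2 fun x a b => (dG x a b).2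
  simp only [hG1, hG2, ℓ0, S0, H0, H10] at g1 g2
  simp only [Complex.cosh_zero, Complex.sinh_zero, mul_zero, mul_one, sub_zero] at g1 g2
  change S s * H1 s = Complex.cosh (ℓ s)
  have hcs := Complex.cosh_sq_sub_sinh_sq (ℓ s)
  linear_combination Complex.cosh (ℓ s) * g1 - Complex.sinh (ℓ s) * g2 - (S s * H1 s) * hcs

end GeneratingFunction

/-! ### The limits of the normalized polynomials -/

/-- The coefficients of the generating function of the orthogonal polynomials at `z`, rotated so
that the singularity nearest to the positive axis is `1`. -/
noncomputable def genCoeff (z : ℂ) (n : ℕ) : ℂ :=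
  if Even n then halfBinom (n / 2) * evenVal z (n / 2) / (2 * n + 1)
  else Complex.I * oddVal z (n / 2) / (2 * n * (2 * n + 1) * halfBinom (n / 2))

lemma genCoeff_even (z : ℂ) (m : ℕ) :
    genCoeff z (2 * m) = halfBinom m * evenVal z m / (4 * m + 1) := by
  rw [genCoeff, if_pos (even_two_mul m), Nat.mul_div_cancel_left m two_pos]
  push_cast
  congr 1; ring

lemma genCoeff_odd (z : ℂ) (m : ℕ) : genCoeff z (2 * m + 1) =
    Complex.I * oddVal z m / ((4 * m + 2) * (4 * m + 3) * halfBinom m) := by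
  rw [genCoeff, if_neg (by simp), show (2 * m + 1) / 2 = m by omega]
  push_cast
  congr 1; ring

lemma halfBinom_ne_zero (m : ℕ) : (halfBinom m : ℂ) ≠ 0 :=
  Complex.ofReal_ne_zero.2 (halfBinom_pos m).ne'

lemma halfBinom_succ_complex (m : ℕ) :
    (halfBinom (m + 1) : ℂ) * (2 * m + 2) = halfBinom m * (2 * m + 1) := by
  exact_mod_cast halfBinom_succ m

lemma genCoeff_bound {z : ℂ} {M : ℝ} (hM : ∀ m, ‖evenVal z m‖ ≤ M ∧ ‖oddVal z m‖ ≤ M) (n : ℕ) :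
    ‖genCoeff z n‖ ≤ M := by
  obtain ⟨m, rfl | rfl⟩ := Nat.even_or_odd' n
  · rw [genCoeff_even, norm_div, norm_mul, Complex.norm_real,
      Real.norm_of_nonneg (halfBinom_pos m).le]
    have e : (4 * m + 1 : ℂ) = ((4 * m + 1 : ℕ) : ℂ) := by push_cast; ring
    rw [e, Complex.norm_natCast, div_le_iff₀ (by positivity)]
    have h1 : halfBinom m ≤ 1 := by
      have := halfBinom_sq_le m
      have h0 := halfBinom_pos m
      have hm : (0 : ℝ) ≤ m := m.cast_nonneg
      nlinarith [mul_nonneg hm (sq_nonneg (halfBinom m))]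
    have h2 := (hM m).1
    have h3 := norm_nonneg (evenVal z m)
    have hm : (0 : ℝ) ≤ m := m.cast_nonneg
    push_cast
    nlinarith [mul_nonneg hm (h3.trans h2), mul_le_mul_of_nonneg_right h1 h3]
  · rw [genCoeff_odd, norm_div, norm_mul, Complex.norm_I, one_mul, norm_mul, norm_mul,
      Complex.norm_real, Real.norm_of_nonneg (halfBinom_pos m).le]
    have e : (4 * m + 2 : ℂ) = ((4 * m + 2 : ℕ) : ℂ) := by push_cast; ring
    have e' : (4 * m + 3 : ℂ) = ((4 * m + 3 : ℕ) : ℂ) := by push_cast; ring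
    have h0 := halfBinom_pos m
    rw [e, e', Complex.norm_natCast, Complex.norm_natCast, div_le_iff₀ (by positivity)]
    have hm : (0 : ℝ) ≤ m := m.cast_nonneg
    have h1 : 1 ≤ (4 * m + 1) * halfBinom m := by
      have := one_le_halfBinom_sq m
      have h2 := halfBinom_sq_le m
      have : halfBinom m ≤ 1 := by
        nlinarith [mul_nonneg hm (sq_nonneg (halfBinom m))]
      nlinarith [mul_nonneg hm h0.le, mul_nonneg h0.le (sub_nonneg.2 this),
        mul_nonneg hm (mul_nonneg h0.le (sub_nonneg.2 this))]
    have h2 := (hM m).2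
    have h3 : 0 ≤ M := (norm_nonneg _).trans h2
    push_cast
    have h4 : 1 ≤ (4 * (m : ℝ) + 2) * (4 * m + 3) * halfBinom m := by
      nlinarith [mul_nonneg hm h0.le, mul_nonneg hm (mul_nonneg hm h0.le)]
    nlinarith

lemma genCoeff_rec {z κ : ℂ} (hκ : κ ^ 2 = Complex.I * z) (n : ℕ) :
    (2 * n + 4) * (2 * n + 5) * genCoeff z (n + 2) =
      κ ^ 2 * genCoeff z (n + 1) + (2 * n + 2) * (2 * n + 1) * genCoeff z n := by
  rw [hκ]
  obtain ⟨m, rfl | rfl⟩ := Nat.even_or_odd' n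
  all_goals
    have h0 := halfBinom_ne_zero m
    -- the linear factors are made opaque, so that clearing denominators only has to cancel them
    obtain ⟨q, hq⟩ : ∃ q : ℂ, q = m + 1 := ⟨_, rfl⟩
    obtain ⟨p, hp⟩ : ∃ p : ℂ, p = 2 * m + 1 := ⟨_, rfl⟩
    obtain ⟨r, hr⟩ : ∃ r : ℂ, r = 2 * m + 3 := ⟨_, rfl⟩
    obtain ⟨d1, hd1⟩ : ∃ d : ℂ, d = 4 * m + 1 := ⟨_, rfl⟩
    obtain ⟨d3, hd3⟩ : ∃ d : ℂ, d = 4 * m + 3 := ⟨_, rfl⟩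
    obtain ⟨d5, hd5⟩ : ∃ d : ℂ, d = 4 * m + 5 := ⟨_, rfl⟩
    obtain ⟨d7, hd7⟩ : ∃ d : ℂ, d = 4 * m + 7 := ⟨_, rfl⟩
    have hq0 : q ≠ 0 := by rw [hq]; exact_mod_cast (by omega : m + 1 ≠ 0)
    have hp0 : p ≠ 0 := by rw [hp]; exact_mod_cast (by omega : 2 * m + 1 ≠ 0)
    have hr0 : r ≠ 0 := by rw [hr]; exact_mod_cast (by omega : 2 * m + 3 ≠ 0)
    have hd10 : d1 ≠ 0 := by rw [hd1]; exact_mod_cast (by omega : 4 * m + 1 ≠ 0)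
    have hd30 : d3 ≠ 0 := by rw [hd3]; exact_mod_cast (by omega : 4 * m + 3 ≠ 0)
    have hd50 : d5 ≠ 0 := by rw [hd5]; exact_mod_cast (by omega : 4 * m + 5 ≠ 0)
    have hd70 : d7 ≠ 0 := by rw [hd7]; exact_mod_cast (by omega : 4 * m + 7 ≠ 0)
    have hc' : (halfBinom (m + 1) : ℂ) = halfBinom m * p / (2 * q) := by
      rw [eq_div_iff (by simpa using hq0), hp, hq]
      linear_combination halfBinom_succ_complex m
  · rw [genCoeff_even, genCoeff_odd, show 2 * m + 2 = 2 * (m + 1) by ring, genCoeff_even,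
      evenVal_succ, oddWeight]
    push_cast
    rw [hc', show (2 * (2 * m) + 4 : ℂ) = 4 * q by rw [hq]; ring,
      show (2 * (2 * m) + 5 : ℂ) = d5 by rw [hd5]; ring,
      show (2 * (2 * m) + 2 : ℂ) = 2 * p by rw [hp]; ring,
      show (2 * (2 * m) + 1 : ℂ) = d1 by rw [hd1]; ring,
      show (4 * m + 2 : ℂ) = 2 * p by rw [hp]; ring,
      show (4 * (m + 1) + 1 : ℂ) = d5 by rw [hd5]; ring, ← hd1, ← hd3]
    clear hq hp hr hd1 hd3 hd5 hd7 hc'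
    field_simp
    rw [Complex.I_sq]
    ring
  · rw [show 2 * m + 1 + 2 = 2 * (m + 1) + 1 by ring, show 2 * m + 1 + 1 = 2 * (m + 1) by ring,
      genCoeff_odd, genCoeff_odd, genCoeff_even, oddVal_succ, evenWeight]
    push_cast
    rw [hc', show (2 * (2 * m + 1) + 4 : ℂ) = 2 * r by rw [hr]; ring,
      show (2 * (2 * m + 1) + 5 : ℂ) = d7 by rw [hd7]; ring,
      show (2 * (2 * m + 1) + 2 : ℂ) = 4 * q by rw [hq]; ring,
      show (2 * (2 * m + 1) + 1 : ℂ) = d3 by rw [hd3]; ring,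
      show (4 * m + 2 : ℂ) = 2 * p by rw [hp]; ring,
      show (4 * (m + 1) + 1 : ℂ) = d5 by rw [hd5]; ring,
      show (4 * (m + 1) + 2 : ℂ) = 2 * r by rw [hr]; ring,
      show (4 * (m + 1) + 3 : ℂ) = d7 by rw [hd7]; ring, ← hd3]
    clear hq hp hr hd1 hd3 hd5 hd7 hc'
    field_simp
    ring

lemma genCoeff_one {z κ : ℂ} (hκ : κ ^ 2 = Complex.I * z) :
    6 * genCoeff z 1 = κ ^ 2 * genCoeff z 0 := by
  have h1 := genCoeff_odd z 0
  have h0 := genCoeff_even z 0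
  simp only [mul_zero, zero_add, Nat.cast_zero, halfBinom_zero, oddVal_zero_right,
    evenVal_zero_right] at h1 h0
  rw [h1, h0, hκ]
  push_cast
  ring

lemma genCoeff_zero (z : ℂ) : genCoeff z 0 = 1 := by
  simp [genCoeff, halfBinom_zero, evenVal_zero_right]

/-- The part of the derivative of the generating function carried by the polynomials of even
degree. -/
noncomputable def evenSeries (z : ℂ) (s : ℝ) : ℂ :=
  ∑' m, halfBinom m * evenVal z m * (s : ℂ) ^ (4 * m)

/-- The part of the derivative of the generating function carried by the polynomials of odd degree,
up to a factor `i s²`. Its coefficients are written as multiples of `c_m`, for use in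
the Abelian theorem. -/
noncomputable def oddSeries (z : ℂ) (s : ℝ) : ℂ :=
  ∑' m : ℕ, halfBinom m * (1 / ((4 * m + 2) * halfBinom m ^ 2) * oddVal z m) * (s : ℂ) ^ (4 * m)

lemma sqrt_mul_series {z κ : ℂ} (hκ : κ ^ 2 = Complex.I * z) {s : ℝ} (hs0 : 0 ≤ s) (hs1 : s < 1) :
    (√(1 - s ^ 4) : ℂ) * (evenSeries z s + Complex.I * ((s : ℂ) ^ 2 * oddSeries z s)) =
      Complex.cosh (κ * quarticArc s) := by
  obtain ⟨M, hM⟩ := exists_val_bound z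
  have hb := genCoeff_bound hM
  rw [← sqrt_mul_genFun_deriv hb (genCoeff_zero z) (genCoeff_one hκ) (genCoeff_rec hκ) hs0 hs1]
  congr 1
  have hsum : Summable fun n : ℕ => (2 * n + 1) * genCoeff z n * (s : ℂ) ^ (2 * n) := by
    refine summable_lacunary (M := 2 * M) (j := 1) (fun n => ?_) (fun n => by omega)
      (by rwa [abs_of_nonneg hs0])
    have : (2 * n + 1 : ℂ) = ((2 * n + 1 : ℕ) : ℂ) := by push_cast; ring
    rw [norm_mul, this, Complex.norm_natCast]
    have h1 := hb n
    have h2 : 0 ≤ M := (norm_nonneg _).trans h1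
    push_cast
    calc (2 * (n : ℝ) + 1) * ‖genCoeff z n‖ ≤ (2 * n + 2) * M := by gcongr; norm_num
      _ = _ := by ring
  have he : Summable fun m : ℕ =>
      (2 * ((2 * m : ℕ) : ℂ) + 1) * genCoeff z (2 * m) * (s : ℂ) ^ (2 * (2 * m)) :=
    hsum.comp_injective (i := fun m => 2 * m) (fun a b h => by simpa using h)
  have ho : Summable fun m : ℕ =>
      (2 * ((2 * m + 1 : ℕ) : ℂ) + 1) * genCoeff z (2 * m + 1) * (s : ℂ) ^ (2 * (2 * m + 1)) :=
    hsum.comp_injective (i := fun m => 2 * m + 1) (fun a b h => by simpa using h)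
  rw [← tsum_even_add_odd (f := fun n : ℕ => (2 * n + 1) * genCoeff z n * (s : ℂ) ^ (2 * n)) he ho]
  congr 1
  · refine tsum_congr fun m => ?_
    have h1 : (4 * m + 1 : ℂ) ≠ 0 := by exact_mod_cast (by omega : 4 * m + 1 ≠ 0)
    have e1 : (2 * ((2 * m : ℕ) : ℂ) + 1) = 4 * m + 1 := by push_cast; ring
    rw [genCoeff_even, e1, mul_div_cancel₀ _ h1, show 2 * (2 * m) = 4 * m by ring]
  · rw [oddSeries, ← tsum_mul_left, ← tsum_mul_left]
    refine tsum_congr fun m => ?_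
    obtain ⟨d2, hd2⟩ : ∃ d : ℂ, d = 4 * m + 2 := ⟨_, rfl⟩
    obtain ⟨d3, hd3⟩ : ∃ d : ℂ, d = 4 * m + 3 := ⟨_, rfl⟩
    have h2 : d2 ≠ 0 := by rw [hd2]; exact_mod_cast (by omega : 4 * m + 2 ≠ 0)
    have h3 : d3 ≠ 0 := by rw [hd3]; exact_mod_cast (by omega : 4 * m + 3 ≠ 0)
    have h0 := halfBinom_ne_zero m
    have e1 : (2 * ((2 * m + 1 : ℕ) : ℂ) + 1) = d3 := by rw [hd3]; push_cast; ring
    rw [genCoeff_odd, e1, ← hd2, ← hd3, show 2 * (2 * m + 1) = 2 + 4 * m by ring, pow_add]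
    clear hd2 hd3 e1
    field_simp

lemma series_neg (z : ℂ) (s : ℝ) :
    evenSeries (-z) s = evenSeries z s ∧ oddSeries (-z) s = -oddSeries z s := by
  constructor
  · exact tsum_congr fun m => by rw [(val_neg z m).1]
  · rw [oddSeries, oddSeries, ← tsum_neg]
    exact tsum_congr fun m => by rw [(val_neg z m).2]; ring

/-- Closed forms of the two parts of the generating function. They are separated by comparing
`z` with `-z`, which only changes the sign of the odd part. -/
lemma series_closed_form (ω : ℂ) {s : ℝ} (hs0 : 0 ≤ s) (hs1 : s < 1) :
    (√(1 - s ^ 4) : ℂ) * evenSeries (ω ^ 2) s =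
      Complex.cosh (ω * (quarticArc s / √2 : ℝ)) * Complex.cos (ω * (quarticArc s / √2 : ℝ)) ∧
    (√(1 - s ^ 4) : ℂ) * ((s : ℂ) ^ 2 * oddSeries (ω ^ 2) s) =
      Complex.sinh (ω * (quarticArc s / √2 : ℝ)) * Complex.sin (ω * (quarticArc s / √2 : ℝ)) := by
  have hr : ((√2 : ℝ) : ℂ) ^ 2 = 2 := by
    rw [← Complex.ofReal_pow, Real.sq_sqrt (by norm_num)]; norm_num
  have hI := Complex.I_sq
  set A : ℂ := ω * (quarticArc s / √2 : ℝ) with hA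
  have k1 : ((1 + Complex.I) / (√2 : ℝ) * ω) ^ 2 = Complex.I * ω ^ 2 := by
    rw [mul_pow, div_pow, hr]
    linear_combination (ω ^ 2 / 2) * hI
  have k2 : ((1 - Complex.I) / (√2 : ℝ) * ω) ^ 2 = Complex.I * (-ω ^ 2) := by
    rw [mul_pow, div_pow, hr]
    linear_combination (ω ^ 2 / 2) * hI
  have e1 := sqrt_mul_series k1 hs0 hs1
  have e2 := sqrt_mul_series k2 hs0 hs1
  have a1 : (1 + Complex.I) / (√2 : ℝ) * ω * quarticArc s = A + A * Complex.I := by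
    rw [hA]; push_cast; ring
  have a2 : (1 - Complex.I) / (√2 : ℝ) * ω * quarticArc s = A - A * Complex.I := by
    rw [hA]; push_cast; ring
  rw [a1, Complex.cosh_add, Complex.cosh_mul_I, Complex.sinh_mul_I] at e1
  rw [a2, Complex.cosh_sub, Complex.cosh_mul_I, Complex.sinh_mul_I, (series_neg _ s).1,
    (series_neg _ s).2] at e2
  constructor
  · linear_combination (e1 + e2) / 2
  · linear_combination (-Complex.I) * (e1 - e2) / 2 -
      (Complex.sinh A * Complex.sin A - (√(1 - s ^ 4) : ℂ) * (s : ℂ) ^ 2 * oddSeries (ω ^ 2) s) * hI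

/-- The binomial series of `(1 - s⁴)^(-1/2)`, read off from the generating function at `z = 0`. -/
lemma hasSum_halfBinom {s : ℝ} (hs0 : 0 ≤ s) (hs1 : s < 1) :
    HasSum (fun m => halfBinom m * s ^ (4 * m)) (1 / √(1 - s ^ 4)) := by
  have h := (series_closed_form 0 hs0 hs1).1
  have hx : ∀ m, evenVal 0 m = 1 := by
    intro m
    induction m with
    | zero => exact evenVal_zero_right 0
    | succ m ih => rw [evenVal_succ, ih]; ring
  rw [evenSeries] at h
  norm_num [hx] at h
  have h2 : √(1 - s ^ 4) * ∑' m, halfBinom m * s ^ (4 * m) = 1 := by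
    exact_mod_cast h
  have hsum : Summable fun m => halfBinom m * s ^ (4 * m) := by
    by_contra hc
    rw [tsum_eq_zero_of_not_summable hc, mul_zero] at h2
    exact zero_ne_one h2
  rw [one_div, ← eq_inv_of_mul_eq_one_right h2]
  exact hsum.hasSum

open Filter Topology in
/-- An Abelian theorem for the weights `√(1 - s⁴) c_m s^(4m)`, which sum to `1` and each of which
tends to `0` as `s → 1`. -/
lemma tendsto_abel_mean {v : ℕ → ℂ} {V : ℂ} (hv : Tendsto v atTop (𝓝 V)) :
    Tendsto (fun s : ℝ => (√(1 - s ^ 4) : ℂ) * ∑' m, halfBinom m * v m * (s : ℂ) ^ (4 * m))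
      (𝓝[<] 1) (𝓝 V) := by
  have hS : Tendsto (fun s : ℝ => √(1 - s ^ 4)) (𝓝[<] 1) (𝓝 0) := by
    have : ContinuousAt (fun s : ℝ => √(1 - s ^ 4)) 1 := by fun_prop
    have h := this.tendsto.mono_left (nhdsWithin_le_nhds (s := Set.Iio 1))
    simpa using h
  rw [Metric.tendsto_nhds]
  intro ε hε
  obtain ⟨N, hN⟩ := Metric.tendsto_atTop.1 hv (ε / 2) (by positivity)
  set B := ∑ m ∈ Finset.range N, halfBinom m * ‖v m - V‖
  have hev : ∀ᶠ s in 𝓝[<] (1 : ℝ), √(1 - s ^ 4) * B < ε / 2 := by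
    have := hS.mul_const B
    rw [zero_mul] at this
    exact this.eventually_lt_const (by positivity)
  have hIoo : ∀ᶠ s in 𝓝[<] (1 : ℝ), s ∈ Set.Ioo (0 : ℝ) 1 := Ioo_mem_nhdsLT one_pos
  filter_upwards [hev, hIoo] with s hsB hs
  have hs0 := hs.1.le
  have hSp : 0 < √(1 - s ^ 4) :=
    Real.sqrt_pos.2 (one_sub_pow_four_pos (by rw [abs_of_nonneg hs0]; exact hs.2))
  have hc := hasSum_halfBinom hs0 hs.2
  have hcC : 
      HasSum (fun m => (halfBinom m : ℂ) * (s : ℂ) ^ (4 * m)) (1 / (√(1 - s ^ 4) : ℝ) : ℂ) := by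
    have := Complex.hasSum_ofReal.2 hc
    push_cast at this
    exact this
  -- the first `N` terms are bounded by `B`, and the others by `ε / 2` times the weights
  have hbound : HasSum (fun m => (if m ∈ Finset.range N then halfBinom m * ‖v m - V‖ else 0) +
      ε / 2 * (halfBinom m * s ^ (4 * m))) (B + ε / 2 * (1 / √(1 - s ^ 4))) := by
    refine HasSum.add ?_ (hc.mul_left _)
    have := hasSum_sum_of_ne_finset_zero (s := Finset.range N) (L := .unconditional ℕ)
      (f := fun m => if m ∈ Finset.range N then halfBinom m * ‖v m - V‖ else 0)
      (fun m hm => if_neg hm)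
    rwa [Finset.sum_congr rfl fun m hm => if_pos hm] at this
  have hle : ∀ m, ‖(halfBinom m : ℂ) * (v m - V) * (s : ℂ) ^ (4 * m)‖ ≤
      (if m ∈ Finset.range N then halfBinom m * ‖v m - V‖ else 0) +
      ε / 2 * (halfBinom m * s ^ (4 * m)) := by
    intro m
    have hcm := halfBinom_pos m
    rw [norm_mul, norm_mul, norm_pow, Complex.norm_real, Complex.norm_real,
      Real.norm_of_nonneg hcm.le, Real.norm_of_nonneg hs0]
    have hp : 0 ≤ s ^ (4 * m) := by positivity
    have hp1 : s ^ (4 * m) ≤ 1 := pow_le_one₀ hs0 hs.2.le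
    split_ifs with h
    · have h1 : 0 ≤ halfBinom m * ‖v m - V‖ := by positivity
      have h2 : 0 ≤ ε / 2 * (halfBinom m * s ^ (4 * m)) := by positivity
      nlinarith
    · have h1 : ‖v m - V‖ ≤ ε / 2 := by
        have := hN m (by simpa using h)
        rw [dist_eq_norm] at this
        exact this.le
      calc halfBinom m * ‖v m - V‖ * s ^ (4 * m) ≤ halfBinom m * (ε / 2) * s ^ (4 * m) := by gcongr
        _ = _ := by ring
  have hsum1 : Summable fun m => (halfBinom m : ℂ) * (v m - V) * (s : ℂ) ^ (4 * m) :=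
    Summable.of_norm_bounded hbound.summable hle
  have hn := tsum_of_norm_bounded hbound hle
  have heq : (√(1 - s ^ 4) : ℂ) * ∑' m, halfBinom m * v m * (s : ℂ) ^ (4 * m) - V =
      (√(1 - s ^ 4) : ℂ) * ∑' m, (halfBinom m : ℂ) * (v m - V) * (s : ℂ) ^ (4 * m) := by
    have h1 := hsum1.hasSum.add (hcC.mul_left V)
    have h2 : ∑' m, halfBinom m * v m * (s : ℂ) ^ (4 * m) =
        ∑' m, (halfBinom m : ℂ) * (v m - V) * (s : ℂ) ^ (4 * m) + V * (1 / (√(1 - s ^ 4) : ℝ)) := by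
      rw [← h1.tsum_eq]
      exact tsum_congr fun m => by ring
    have h3 : ((√(1 - s ^ 4) : ℝ) : ℂ) ≠ 0 := Complex.ofReal_ne_zero.2 hSp.ne'
    rw [h2]
    field_simp
    ring
  rw [dist_eq_norm, heq, norm_mul, Complex.norm_real, Real.norm_of_nonneg hSp.le]
  calc √(1 - s ^ 4) * ‖∑' m, (halfBinom m : ℂ) * (v m - V) * (s : ℂ) ^ (4 * m)‖
      ≤ √(1 - s ^ 4) * (B + ε / 2 * (1 / √(1 - s ^ 4))) := by gcongr
    _ = √(1 - s ^ 4) * B + ε / 2 := by field_simp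
    _ < ε := by linarith

open Filter Topology in
/-- Wallis' formula; the terms are the ratios of the coefficients of `y_m` and of `x_m` in the
generating function. -/
lemma tendsto_wallis_halfBinom :
    Tendsto (fun m : ℕ => 1 / ((4 * m + 2) * halfBinom m ^ 2)) atTop (𝓝 (Real.pi / 4)) := by
  have h : (fun m : ℕ => 1 / ((4 * m + 2) * halfBinom m ^ 2)) = fun m => Real.Wallis.W m / 2 := by
    funext m
    induction m with
    | zero => simp [halfBinom_zero, Real.Wallis.W]
    | succ m ih =>
      have := (halfBinom_pos m).ne'
      rw [Real.Wallis.W_succ, mul_div_right_comm, ← ih, halfBinom_succ_eq]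
      push_cast
      field_simp
      ring
  rw [h]
  have := Real.Wallis.tendsto_W_nhds_pi_div_two.div_const 2
  convert this using 2
  ring

open Filter Topology in
/-- The limits of `x_m(ω²)` and `y_m(ω²)` in terms of the complete elliptic integral `Λ`,
the limit of `quarticArc` at `1`. -/
lemma lim_closed_form {Λ : ℝ} (hΛ : Tendsto quarticArc (𝓝[<] 1) (𝓝 Λ)) (ω : ℂ) :
    evenLim (ω ^ 2) = Complex.cosh (ω * (Λ / √2 : ℝ)) * Complex.cos (ω * (Λ / √2 : ℝ)) ∧
    oddLim (ω ^ 2) =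
      4 / Real.pi * (Complex.sinh (ω * (Λ / √2 : ℝ)) * Complex.sin (ω * (Λ / √2 : ℝ))) := by
  have hIoo : ∀ᶠ s in 𝓝[<] (1 : ℝ), s ∈ Set.Ioo (0 : ℝ) 1 := Ioo_mem_nhdsLT one_pos
  have hA : Tendsto (fun s => ω * (quarticArc s / √2 : ℝ)) (𝓝[<] 1) (𝓝 (ω * (Λ / √2 : ℝ))) :=
    ((Complex.continuous_ofReal.tendsto _).comp (hΛ.div_const _)).const_mul ω
  have t (f : ℂ → ℂ) (hf : Continuous f) := (hf.tendsto _).comp hA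
  constructor
  · have h1 := tendsto_abel_mean (tendsto_evenVal (ω ^ 2))
    have h2 := (t _ Complex.continuous_cosh).mul (t _ Complex.continuous_cos)
    refine tendsto_nhds_unique_of_eventuallyEq h1 h2 ?_
    filter_upwards [hIoo] with s hs
    exact (series_closed_form ω hs.1.le hs.2).1
  · have hw : Tendsto (fun m : ℕ => 1 / ((4 * m + 2) * (halfBinom m : ℂ) ^ 2) * oddVal (ω ^ 2) m)
        atTop (𝓝 ((Real.pi / 4 : ℝ) * oddLim (ω ^ 2))) := by
      refine Tendsto.mul ?_ (tendsto_oddVal _)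
      have := (Complex.continuous_ofReal.tendsto _).comp tendsto_wallis_halfBinom
      refine this.congr fun m => ?_
      simp
    have h0 : Tendsto (fun s : ℝ => (s : ℂ) ^ 2) (𝓝[<] 1) (𝓝 1) := by
      have : Continuous fun s : ℝ => (s : ℂ) ^ 2 := by fun_prop
      have h := (this.tendsto 1).mono_left (nhdsWithin_le_nhds (s := Set.Iio 1))
      simpa using h
    have h1 := h0.mul (tendsto_abel_mean hw)
    have h2 := (t _ Complex.continuous_sinh).mul (t _ Complex.continuous_sin)
    have h3 := tendsto_nhds_unique_of_eventuallyEq h1 h2 (by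
      filter_upwards [hIoo] with s hs
      have := (series_closed_form ω hs.1.le hs.2).2
      rw [oddSeries] at this
      simp only [Function.comp_apply]
      rw [← this]
      ring)
    rw [← h3]
    have hpi : (Real.pi : ℂ) ≠ 0 := Complex.ofReal_ne_zero.2 Real.pi_ne_zero
    push_cast
    field_simp

/-! ### The complete elliptic integral -/

open MeasureTheory in
/-- The substitution `y = x⁴` turns the complete elliptic integral into a Beta integral. -/
lemma integral_one_div_sqrt_quartic :
    IntervalIntegrable (fun x : ℝ => 1 / √(1 - x ^ 4)) volume 0 1 ∧
      ∫ x in (0 : ℝ)..1, 1 / √(1 - x ^ 4) = (1 / 4) * ProbabilityTheory.beta (1 / 4) (1 / 2) := by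
  set β : ℝ → ℂ := fun y => (y : ℂ) ^ (((1 / 4 : ℝ) : ℂ) - 1) *
    (1 - (y : ℂ)) ^ (((1 / 2 : ℝ) : ℂ) - 1) with hβ
  set g : ℝ → ℂ := (Set.Ioc (0 : ℝ) 1).indicator β with hg
  have hsub : Set.Ioc (0 : ℝ) 1 ∩ Set.Ioi 0 = Set.Ioc 0 1 :=
    Set.inter_eq_left.2 fun x hx => hx.1
  have hβint : IntegrableOn β (Set.Ioc 0 1) :=
    (intervalIntegrable_iff_integrableOn_Ioc_of_le zero_le_one).1
      (Complex.betaIntegral_convergent (u := ((1 / 4 : ℝ) : ℂ)) (v := ((1 / 2 : ℝ) : ℂ))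
        (by norm_num) (by norm_num))
  have hgint : IntegrableOn g (Set.Ioi 0) := by
    rw [hg, IntegrableOn, integrable_indicator_iff measurableSet_Ioc, IntegrableOn,
      Measure.restrict_restrict measurableSet_Ioc, hsub]
    exact hβint
  have hgI : ∫ y in Set.Ioi 0, g y = Complex.betaIntegral ((1 / 4 : ℝ) : ℂ) ((1 / 2 : ℝ) : ℂ) := by
    rw [hg, setIntegral_indicator measurableSet_Ioc, Set.inter_comm, hsub, Complex.betaIntegral,
      intervalIntegral.integral_of_le zero_le_one]
  -- at `x = 1` both integrands vanish, because `1 / 0 = 0` and `0 ^ (-1/2) = 0`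
  have hpt : ∀ x ∈ Set.Ioi (0 : ℝ), (|(4 : ℝ)| * x ^ ((4 : ℝ) - 1)) • g (x ^ (4 : ℝ)) =
      (Set.Ioc (0 : ℝ) 1).indicator (fun x : ℝ => ((4 * (1 / √(1 - x ^ 4)) : ℝ) : ℂ)) x := by
    intro x hx
    have hx0 : 0 < x := hx
    have e4 : x ^ (4 : ℝ) = x ^ 4 := by exact_mod_cast Real.rpow_natCast x 4
    have e3 : x ^ ((4 : ℝ) - 1) = x ^ 3 := by
      rw [show (4 : ℝ) - 1 = ((3 : ℕ) : ℝ) by norm_num, Real.rpow_natCast]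
    rw [e4, e3, hg]
    by_cases hx1 : x ≤ 1
    · have hx4 : x ^ 4 ≤ 1 := pow_le_one₀ hx0.le hx1
      rw [Set.indicator_of_mem (show x ^ 4 ∈ Set.Ioc (0 : ℝ) 1 from ⟨by positivity, hx4⟩),
        Set.indicator_of_mem (show x ∈ Set.Ioc (0 : ℝ) 1 from ⟨hx0, hx1⟩)]
      have h1 : ((x ^ 4 : ℝ) : ℂ) ^ (((1 / 4 : ℝ) : ℂ) - 1) = (((x ^ 3)⁻¹ : ℝ) : ℂ) := by
        rw [← Complex.ofReal_one, ← Complex.ofReal_sub, ← Complex.ofReal_cpow (by positivity)]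
        congr 1
        rw [← Real.rpow_natCast, ← Real.rpow_natCast, ← Real.rpow_mul hx0.le,
          ← Real.rpow_neg hx0.le]
        norm_num
      have h2 : (1 - ((x ^ 4 : ℝ) : ℂ)) ^ (((1 / 2 : ℝ) : ℂ) - 1) =
          ((1 / √(1 - x ^ 4) : ℝ) : ℂ) := by
        rw [← Complex.ofReal_one, ← Complex.ofReal_sub, ← Complex.ofReal_sub,
          ← Complex.ofReal_cpow (by linarith)]
        congr 1
        rw [Real.sqrt_eq_rpow, one_div ((1 - x ^ 4) ^ (1 / 2 : ℝ)), ← Real.rpow_neg (by linarith)]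
        norm_num
      simp only [hβ]
      rw [h1, h2, Complex.real_smul, abs_of_pos (by norm_num : (0 : ℝ) < 4), ← Complex.ofReal_mul,
        ← Complex.ofReal_mul]
      congr 1
      field_simp
    · have hx4 : ¬ x ^ 4 ≤ 1 := by
        have := one_lt_pow₀ (not_le.1 hx1) (four_ne_zero)
        exact not_le.2 this
      rw [Set.indicator_of_notMem (fun h => hx4 h.2), Set.indicator_of_notMem (fun h => hx1 h.2),
        smul_zero]
  have hint := (integrableOn_Ioi_comp_rpow_iff g (four_ne_zero' ℝ)).2 hgint
  have hI := integral_comp_rpow_Ioi g (four_ne_zero' ℝ)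
  rw [integrableOn_congr_fun hpt measurableSet_Ioi, IntegrableOn,
    integrable_indicator_iff measurableSet_Ioc, IntegrableOn,
    Measure.restrict_restrict measurableSet_Ioc, hsub] at hint
  rw [setIntegral_congr_fun measurableSet_Ioi hpt, hgI, setIntegral_indicator measurableSet_Ioc,
    Set.inter_comm, hsub, integral_complex_ofReal, integral_const_mul] at hI
  constructor
  · rw [intervalIntegrable_iff_integrableOn_Ioc_of_le zero_le_one]
    have h1 : IntegrableOn (fun x : ℝ => 4 * (1 / √(1 - x ^ 4))) (Set.Ioc 0 1) := by
      simpa [IntegrableOn] using hint.re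
    have h2 := h1.const_mul (1 / 4)
    refine h2.congr (Filter.Eventually.of_forall fun x => ?_)
    simp only
    ring
  · rw [intervalIntegral.integral_of_le zero_le_one,
      ProbabilityTheory.beta_eq_betaIntegralReal _ _ (by norm_num) (by norm_num), ← hI,
      Complex.ofReal_re]
    ring

/-- Euler's reflection formula evaluates the Beta integral. -/
lemma beta_eq_kZero : (1 / 4) * ProbabilityTheory.beta (1 / 4) (1 / 2) = kZero / √2 := by
  have hrefl := Real.Gamma_mul_Gamma_one_sub (1 / 4)
  have hsin : Real.sin (Real.pi * (1 / 4)) = √2 / 2 := by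
    rw [mul_one_div, Real.sin_pi_div_four]
  rw [hsin, show (1 : ℝ) - 1 / 4 = 3 / 4 by norm_num] at hrefl
  have h54 : Real.Gamma (5 / 4) = 1 / 4 * Real.Gamma (1 / 4) := by
    rw [← Real.Gamma_add_one (by norm_num)]; norm_num
  have hG : Real.Gamma (3 / 4) ≠ 0 := (Real.Gamma_pos_of_pos (by norm_num)).ne'
  have hpi : √Real.pi ≠ 0 := (Real.sqrt_pos.2 Real.pi_pos).ne'
  have hpisq : √Real.pi * √Real.pi = Real.pi := Real.mul_self_sqrt Real.pi_pos.le
  have h2 : √2 ≠ 0 := by positivity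
  have h2sq : √2 * √2 = 2 := Real.mul_self_sqrt (by norm_num)
  rw [ProbabilityTheory.beta, kZero, Real.Gamma_one_half_eq, h54,
    show (1 / 4 : ℝ) + 1 / 2 = 3 / 4 by norm_num]
  rw [eq_div_iff (by positivity)] at hrefl
  rw [eq_div_iff h2, mul_div_assoc', div_mul_eq_mul_div, div_eq_div_iff hG hpi]
  -- both sides are `Γ(1/4) π √2 / 4`
  have h3 : Real.Gamma (1 / 4) * Real.Gamma (3 / 4) = Real.pi * √2 := by
    apply mul_right_cancel₀ (show √2 / 2 ≠ 0 by positivity)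
    rw [hrefl]
    linear_combination (-Real.pi / 2) * h2sq
  linear_combination (1 / 4 * Real.Gamma (1 / 4) * √2) * hpisq - (1 / 4 * Real.Gamma (1 / 4)) * h3

open Filter Topology MeasureTheory in
lemma tendsto_quarticArc : Tendsto quarticArc (𝓝[<] 1) (𝓝 (kZero / √2)) := by
  obtain ⟨hi, hI⟩ := integral_one_div_sqrt_quartic
  have h1 : ContinuousOn quarticArc (Set.uIcc 0 1) :=
    intervalIntegral.continuousOn_primitive_interval
      (by rwa [Set.uIcc_of_le zero_le_one,
        ← intervalIntegrable_iff_integrableOn_Icc_of_le zero_le_one])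
  have h2 : Tendsto quarticArc (𝓝[Set.uIcc 0 1] 1) (𝓝 (quarticArc 1)) :=
    h1 1 Set.right_mem_uIcc
  rw [quarticArc, hI, beta_eq_kZero] at h2
  refine h2.mono_left ?_
  rw [Set.uIcc_of_le zero_le_one, nhdsWithin_Icc_eq_nhdsLE one_pos]
  exact nhdsWithin_mono _ Set.Iio_subset_Iic_self

/-- The Nevanlinna functions of the quartic process at `ω²`, up to sign. -/
lemma lim_closed_form_kZero (ω : ℂ) :
    evenLim (ω ^ 2) = Complex.cosh (ω * (kZero / 2 : ℝ)) * Complex.cos (ω * (kZero / 2 : ℝ)) ∧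
    oddLim (ω ^ 2) =
      4 / Real.pi * (Complex.sinh (ω * (kZero / 2 : ℝ)) * Complex.sin (ω * (kZero / 2 : ℝ))) := by
  have h := lim_closed_form tendsto_quarticArc ω
  rwa [div_div, Real.mul_self_sqrt (by norm_num)] at h

/-! ### The closed form on the unit circle -/

/-- The closed form of `∑ |p_n(e^{iθ})|²` for `sin θ ≠ 0`; at the other points, which form a null
set, division by zero makes it `0`. -/
noncomputable def circleKernel (θ : ℝ) : ℝ :=
  1 / (Real.pi * Real.sin θ) *
    (Real.sinh (kZero * Real.cos (θ / 2)) * Real.sinh (kZero * Real.sin (θ / 2)) +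
      Real.sin (kZero * Real.cos (θ / 2)) * Real.sin (kZero * Real.sin (θ / 2)))

lemma circlePoint_sub (θ : ℝ) :
    circlePoint θ - circlePoint (-θ) = 2 * Complex.I * Real.sin θ := by
  rw [circlePoint, circlePoint, Complex.ofReal_neg, Complex.ofReal_sin, Complex.sin]
  simp only [neg_mul]
  linear_combination (Complex.exp (θ * Complex.I) - Complex.exp (-(θ * Complex.I))) * Complex.I_sq

lemma conj_circlePoint (θ : ℝ) : starRingEnd ℂ (circlePoint θ) = circlePoint (-θ) := by
  rw [circlePoint, circlePoint, ← Complex.exp_conj]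
  simp

lemma circlePoint_eq_sq (θ : ℝ) : circlePoint θ = circlePoint (θ / 2) ^ 2 := by
  rw [circlePoint, circlePoint, ← Complex.exp_nat_mul]
  congr 1
  push_cast
  ring

/-- With `a` and `b` equal to `K₀/2` times `e^{iθ/2}` and `e^{-iθ/2}`, the addition theorems express
the Wronskian of the Nevanlinna functions through `a + b = K₀ cos(θ/2)` and
`a - b = i K₀ sin(θ/2)`. -/
lemma lim_circlePoint (θ : ℝ) (hθ : Real.sin θ ≠ 0) :
    (oddLim (circlePoint θ) * evenLim (circlePoint (-θ)) -
      evenLim (circlePoint θ) * oddLim (circlePoint (-θ))) / (circlePoint θ - circlePoint (-θ)) =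
      (circleKernel θ : ℂ) := by
  have hpi : (Real.pi : ℂ) ≠ 0 := Complex.ofReal_ne_zero.2 Real.pi_ne_zero
  rw [circlePoint_sub, circlePoint_eq_sq θ, circlePoint_eq_sq (-θ), (lim_closed_form_kZero _).1,
    (lim_closed_form_kZero _).1, (lim_closed_form_kZero _).2, (lim_closed_form_kZero _).2]
  set a : ℂ := circlePoint (θ / 2) * (kZero / 2 : ℝ) with ha
  set b : ℂ := circlePoint (-θ / 2) * (kZero / 2 : ℝ) with hb
  have hp : ((kZero * Real.cos (θ / 2) : ℝ) : ℂ) = a + b := by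
    rw [ha, hb, circlePoint, circlePoint]
    push_cast
    simp only [Complex.cos, neg_div, neg_mul]
    ring
  have hm : ((kZero * Real.sin (θ / 2) : ℝ) : ℂ) = -Complex.I * (a - b) := by
    rw [ha, hb, circlePoint, circlePoint]
    push_cast
    simp only [Complex.sin, neg_div, neg_mul]
    ring
  have hsh : Complex.sinh ((kZero * Real.sin (θ / 2) : ℝ) : ℂ) =
      -Complex.I * Complex.sin (a - b) := by
    rw [hm, neg_mul, Complex.sinh_neg, mul_comm Complex.I, Complex.sinh_mul_I]
    ring
  have hsi : Complex.sin ((kZero * Real.sin (θ / 2) : ℝ) : ℂ) =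
      -Complex.I * Complex.sinh (a - b) := by
    rw [hm, neg_mul, Complex.sin_neg, mul_comm Complex.I, Complex.sin_mul_I]
    ring
  rw [circleKernel]
  push_cast at hsh hsi hp ⊢
  rw [hsh, hsi, hp, Complex.sin_add, Complex.sin_sub, Complex.sinh_add, Complex.sinh_sub]
  have hs' : Complex.sin θ ≠ 0 := by rw [← Complex.ofReal_sin]; exact Complex.ofReal_ne_zero.2 hθ
  rw [div_eq_iff (by simpa using hs'), one_div, mul_assoc]
  field_simp
  linear_combination (4 * (Complex.sinh a * Complex.sin a * (Complex.cosh b * Complex.cos b) -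
    Complex.cosh a * Complex.cos a * (Complex.sinh b * Complex.sin b))) * Complex.I_sq

/-! ### The double series -/

/-- The integrals over a period of `cos(θ/2)^(2m) sin(θ/2)^(2n)`. -/
noncomputable def trigIntegral (m n : ℕ) : ℝ :=
  ∫ θ in (0 : ℝ)..(2 * Real.pi), Real.cos (θ / 2) ^ (2 * m) * Real.sin (θ / 2) ^ (2 * n)

lemma intervalIntegrable_trig (m n : ℕ) (a b : ℝ) : IntervalIntegrable
    (fun θ : ℝ => Real.cos (θ / 2) ^ m * Real.sin (θ / 2) ^ n) MeasureTheory.volume a b :=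
  Continuous.intervalIntegrable (by fun_prop) a b

lemma trigIntegral_add (m n : ℕ) :
    trigIntegral (m + 1) n + trigIntegral m (n + 1) = trigIntegral m n := by
  rw [trigIntegral, trigIntegral, trigIntegral, ← intervalIntegral.integral_add
    (intervalIntegrable_trig _ _ _ _) (intervalIntegrable_trig _ _ _ _)]
  congr 1
  funext θ
  have := Real.cos_sq_add_sin_sq (θ / 2)
  linear_combination (Real.cos (θ / 2) ^ (2 * m) * Real.sin (θ / 2) ^ (2 * n)) * this

/-- Integration of the derivative of `cos(θ/2)^(2m+1) sin(θ/2)^(2n+1)` over a period. -/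
lemma trigIntegral_parts (m n : ℕ) :
    (2 * n + 1) * trigIntegral (m + 1) n = (2 * m + 1) * trigIntegral m (n + 1) := by
  set f : ℝ → ℝ := fun θ => Real.cos (θ / 2) ^ (2 * m + 1) * Real.sin (θ / 2) ^ (2 * n + 1) with hf
  set f' : ℝ → ℝ := fun θ =>
    (2 * n + 1) / 2 * (Real.cos (θ / 2) ^ (2 * (m + 1)) * Real.sin (θ / 2) ^ (2 * n)) -
    (2 * m + 1) / 2 * (Real.cos (θ / 2) ^ (2 * m) * Real.sin (θ / 2) ^ (2 * (n + 1))) with hf'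
  have hd : ∀ θ ∈ Set.uIcc 0 (2 * Real.pi), HasDerivAt f (f' θ) θ := by
    intro θ _
    have h1 : HasDerivAt (fun θ : ℝ => θ / 2) (1 / 2) θ := (hasDerivAt_id θ).div_const 2
    have h2 := (h1.cos.pow (2 * m + 1)).mul (h1.sin.pow (2 * n + 1))
    convert! h2 using 1
    simp only [hf', Nat.add_sub_cancel, Pi.pow_apply]
    push_cast
    ring
  have h := intervalIntegral.integral_eq_sub_of_hasDerivAt hd
    (Continuous.intervalIntegrable (by fun_prop) _ _)
  have h0 : f (2 * Real.pi) - f 0 = 0 := by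
    simp [hf]
  rw [h0, hf', intervalIntegral.integral_sub ((intervalIntegrable_trig _ _ _ _).const_mul _)
    ((intervalIntegrable_trig _ _ _ _).const_mul _), intervalIntegral.integral_const_mul,
    intervalIntegral.integral_const_mul] at h
  change (2 * n + 1) / 2 * trigIntegral (m + 1) n -
    (2 * m + 1) / 2 * trigIntegral m (n + 1) = 0 at h
  linarith

lemma trigIntegral_succ_left (m n : ℕ) :
    (2 * (m + n) + 2) * trigIntegral (m + 1) n = (2 * m + 1) * trigIntegral m n := by
  linear_combination trigIntegral_parts m n + (2 * m + 1) * trigIntegral_add m n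

lemma trigIntegral_succ_right (m n : ℕ) :
    (2 * (m + n) + 2) * trigIntegral m (n + 1) = (2 * n + 1) * trigIntegral m n := by
  linear_combination (2 * n + 1) * trigIntegral_add m n - trigIntegral_parts m n

/-- Wallis integrals with two exponents. -/
lemma trigIntegral_eq (m n : ℕ) : trigIntegral m n * (4 ^ (m + n) * m.factorial * n.factorial *
    (m + n).factorial) = 2 * Real.pi * ((2 * m).factorial * (2 * n).factorial) := by
  induction m with
  | zero =>
    induction n with
    | zero => simp [trigIntegral]
    | succ n ih =>
      have h := trigIntegral_succ_right 0 n
      rw [show 2 * (n + 1) = 2 * n + 1 + 1 by ring, ← add_assoc]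
      simp only [Nat.factorial_succ, pow_succ, zero_add] at ih ⊢
      push_cast at ih h ⊢
      linear_combination (2 * (2 * n + 2) * (2 * n + 1)) / 2 * ih +
        (2 * (n + 1) * (4 ^ n * (n.factorial : ℝ) * n.factorial) * (0).factorial) * h
  | succ m ih =>
    have h := trigIntegral_succ_left m n
    rw [show 2 * (m + 1) = 2 * m + 1 + 1 by ring, show m + 1 + n = m + n + 1 by ring]
    simp only [Nat.factorial_succ, pow_succ] at ih ⊢
    push_cast at ih h ⊢
    linear_combination ((2 * m + 2) * (2 * m + 1)) * ih +
      (2 * (m + 1) * (4 ^ (m + n) * (m.factorial : ℝ) * n.factorial * (m + n).factorial)) * h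

/-- The pairs of indices of the double series. -/
abbrev EvenPair := {mn : ℕ × ℕ // Even (mn.1 + mn.2)}

/-- The general term of the expansion of `circleKernel` in powers of `cos(θ/2)` and `sin(θ/2)`. -/
noncomputable def kernelTerm (mn : EvenPair) (θ : ℝ) : ℝ :=
  kZero ^ (2 * mn.1.1 + 1) / (2 * mn.1.1 + 1).factorial *
    (kZero ^ (2 * mn.1.2 + 1) / (2 * mn.1.2 + 1).factorial) / Real.pi *
    (Real.cos (θ / 2) ^ (2 * mn.1.1) * Real.sin (θ / 2) ^ (2 * mn.1.2))

/-- A bound of `kernelTerm` that does not depend on the angle. -/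
noncomputable def kernelBound (mn : EvenPair) : ℝ :=
  kZero ^ (2 * mn.1.1 + 1) / (2 * mn.1.1 + 1).factorial *
    (kZero ^ (2 * mn.1.2 + 1) / (2 * mn.1.2 + 1).factorial) / Real.pi

lemma kZero_pos : 0 < kZero := by
  have h1 := Real.Gamma_pos_of_pos (show (0 : ℝ) < 1 / 4 by norm_num)
  have h2 := Real.Gamma_pos_of_pos (show (0 : ℝ) < 5 / 4 by norm_num)
  have := Real.pi_pos
  unfold kZero
  positivity

lemma summable_kernelBound : Summable kernelBound := by
  have h := (Real.hasSum_sinh kZero).summable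
  have h2 := (h.mul_of_nonneg h (fun n => by have := kZero_pos; positivity)
    (fun n => by have := kZero_pos; positivity)).div_const Real.pi
  exact h2.comp_injective Subtype.val_injective

lemma norm_kernelTerm_le (mn : EvenPair) (θ : ℝ) : ‖kernelTerm mn θ‖ ≤ kernelBound mn := by
  have hK := kZero_pos
  have hpi := Real.pi_pos
  have hb : 0 ≤ kernelBound mn := by unfold kernelBound; positivity
  have h1 : |Real.cos (θ / 2) ^ (2 * mn.1.1) * Real.sin (θ / 2) ^ (2 * mn.1.2)| ≤ 1 := by
    rw [abs_mul, abs_pow, abs_pow]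
    exact mul_le_one₀ (pow_le_one₀ (abs_nonneg _) (Real.abs_cos_le_one _)) (by positivity)
      (pow_le_one₀ (abs_nonneg _) (Real.abs_sin_le_one _))
  change ‖kernelBound mn * _‖ ≤ _
  rw [norm_mul, Real.norm_of_nonneg hb, Real.norm_eq_abs]
  exact mul_le_of_le_one_right hb h1

lemma continuous_kernelTerm (mn : EvenPair) : Continuous (kernelTerm mn) := by
  unfold kernelTerm
  fun_prop

/-- In a product of two series and the product of their alternating versions, the terms with
`m + n` odd cancel. -/
lemma hasSum_even_pairs {A B : ℕ → ℝ} {x y x' y' : ℝ} (hA : HasSum A x) (hB : HasSum B y)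
    (hA' : HasSum (fun n => (-1) ^ n * A n) x') (hB' : HasSum (fun n => (-1) ^ n * B n) y') :
    HasSum (fun mn : EvenPair => 2 * (A mn.1.1 * B mn.1.2)) (x * y + x' * y') := by
  have h1 := hA.mul hB (summable_mul_of_summable_norm hA.summable.norm hB.summable.norm)
  have h2 := hA'.mul hB' (summable_mul_of_summable_norm hA'.summable.norm hB'.summable.norm)
  set G : ℕ × ℕ → ℝ := fun mn => (1 + (-1) ^ (mn.1 + mn.2)) * (A mn.1 * B mn.2) with hG
  have h3 : HasSum G (x * y + x' * y') := by
    refine (h1.add h2).congr_fun fun mn => ?_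
    simp only [hG]
    ring
  have hsupp : Function.support G ⊆ {mn : ℕ × ℕ | Even (mn.1 + mn.2)} := by
    intro mn hmn
    by_contra hodd
    apply hmn
    simp only [hG]
    rw [(Nat.not_even_iff_odd.1 hodd).neg_one_pow]
    ring
  have h4 := (hasSum_subtype_iff_of_support_subset hsupp).2 h3
  have h5 : (fun mn : EvenPair => 2 * (A mn.1.1 * B mn.1.2)) = G ∘ (↑) := by
    funext mn
    simp only [Function.comp_apply, hG]
    rw [mn.2.neg_one_pow]
    ring
  rw [h5]
  exact h4

/-- Expansion of the closed form, whose denominator `sin θ = 2 sin(θ/2) cos(θ/2)` cancels. -/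
lemma hasSum_kernelTerm {θ : ℝ} (hθ : Real.sin θ ≠ 0) :
    HasSum (fun mn => kernelTerm mn θ) (circleKernel θ) := by
  have hdouble : Real.sin θ = 2 * Real.sin (θ / 2) * Real.cos (θ / 2) := by
    rw [← Real.sin_two_mul]; congr 1; ring
  rw [hdouble] at hθ
  have hs : Real.sin (θ / 2) ≠ 0 := by rintro h; simp [h] at hθ
  have hc : Real.cos (θ / 2) ≠ 0 := by rintro h; simp [h] at hθ
  have si : ∀ x : ℝ,
      HasSum (fun n : ℕ => (-1) ^ n * (x ^ (2 * n + 1) / ((2 * n + 1).factorial : ℝ)))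
      (Real.sin x) := by
    intro x
    simpa only [mul_div_assoc] using Real.hasSum_sin x
  have h := (hasSum_even_pairs (Real.hasSum_sinh (kZero * Real.cos (θ / 2)))
    (Real.hasSum_sinh (kZero * Real.sin (θ / 2))) (si _) (si _)).mul_left
    (1 / (Real.pi * Real.sin θ))
  rw [circleKernel]
  refine h.congr_fun fun mn => ?_
  rw [kernelTerm, hdouble]
  have hpi := Real.pi_ne_zero
  have hf1 : ((2 * mn.1.1 + 1).factorial : ℝ) ≠ 0 := by positivity
  have hf2 : ((2 * mn.1.2 + 1).factorial : ℝ) ≠ 0 := by positivity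
  generalize ((2 * mn.1.1 + 1).factorial : ℝ) = f1 at hf1 ⊢
  generalize ((2 * mn.1.2 + 1).factorial : ℝ) = f2 at hf2 ⊢
  field_simp
  ring

lemma ae_sin_ne_zero : ∀ᵐ θ : ℝ, Real.sin θ ≠ 0 := by
  have h : {θ : ℝ | ¬ Real.sin θ ≠ 0} = Set.range fun n : ℤ => (n : ℝ) * Real.pi := by
    ext θ
    simp only [not_not, Set.mem_ofPred_eq, Set.mem_range]
    exact Real.sin_eq_zero_iff
  rw [MeasureTheory.ae_iff, h]
  exact (Set.countable_range _).measure_zero _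

lemma circleKernel_ae_eq :
    circleKernel =ᵐ[MeasureTheory.volume] fun θ => ∑' mn, kernelTerm mn θ := by
  filter_upwards [ae_sin_ne_zero] with θ hθ
  exact (hasSum_kernelTerm hθ).tsum_eq.symm

lemma intervalIntegrable_circleKernel (a b : ℝ) :
    IntervalIntegrable circleKernel MeasureTheory.volume a b := by
  have h : Continuous fun θ => ∑' mn, kernelTerm mn θ :=
    continuous_tsum continuous_kernelTerm summable_kernelBound norm_kernelTerm_le
  exact (h.intervalIntegrable a b).congr_ae
    (MeasureTheory.ae_restrict_of_ae circleKernel_ae_eq.symm)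

lemma integral_kernelTerm (mn : EvenPair) :
    ∫ θ in (0 : ℝ)..(2 * Real.pi), kernelTerm mn θ =
      2 * Real.pi * (kZero ^ 2 / Real.pi) * rhoTerm mn.1.1 mn.1.2 := by
  obtain ⟨⟨m, n⟩, hmn⟩ := mn
  have h := trigIntegral_eq m n
  have hpi := Real.pi_ne_zero
  simp only [kernelTerm, rhoTerm]
  rw [intervalIntegral.integral_const_mul]
  change _ * trigIntegral m n = _
  have hf : ∀ k : ℕ, (k.factorial : ℝ) ≠ 0 := fun k => by positivity
  have h0 : (4 : ℝ) ^ (m + n) * m.factorial * n.factorial * (m + n).factorial ≠ 0 := by positivity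
  rw [← eq_div_iff h0] at h
  rw [h, Nat.factorial_succ, Nat.factorial_succ, div_pow,
    show (2 : ℝ) ^ (2 * m + 2 * n) = 4 ^ (m + n) by rw [← mul_add, pow_mul]; norm_num]
  have h1 := hf m
  have h2 := hf n
  have h3 := hf (m + n)
  have h4 := hf (2 * m)
  have h5 := hf (2 * n)
  push_cast
  field_simp
  ring

/-- Termwise integration of the expansion of `circleKernel`. -/
lemma hasSum_rhoTerm : HasSum (fun mn : EvenPair => rhoTerm mn.1.1 mn.1.2)
    ((2 * Real.pi * (kZero ^ 2 / Real.pi))⁻¹ *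
      ∫ θ in (0 : ℝ)..(2 * Real.pi), circleKernel θ) := by
  have h : HasSum (fun mn : EvenPair => ∫ θ in (0 : ℝ)..(2 * Real.pi), kernelTerm mn θ)
      (∫ θ in (0 : ℝ)..(2 * Real.pi), circleKernel θ) := by
    refine intervalIntegral.hasSum_integral_of_dominated_convergence
      (fun mn _ => kernelBound mn) (fun mn => ?_) (fun mn => ?_) ?_ ?_ ?_
    · exact (continuous_kernelTerm mn).aestronglyMeasurable
    · exact Filter.Eventually.of_forall fun θ _ => norm_kernelTerm_le mn θ
    · exact Filter.Eventually.of_forall fun θ _ => summable_kernelBound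
    · exact intervalIntegrable_const
    · filter_upwards [ae_sin_ne_zero] with θ hθ _
      exact hasSum_kernelTerm hθ
  have hne : 2 * Real.pi * (kZero ^ 2 / Real.pi) ≠ 0 := by
    have := kZero_pos
    have := Real.pi_pos
    positivity
  have h2 := h.mul_left (2 * Real.pi * (kZero ^ 2 / Real.pi))⁻¹
  simp only [integral_kernelTerm, inv_mul_cancel_left₀ hne] at h2
  exact h2

/-! ### The orthonormal polynomials of the quartic process -/

/-- The orthonormal polynomials of the symmetrized quartic problem. -/
noncomputable def quarticPoly : ℕ → ℝ[X] := stringOrthonormal evenWeight oddWeight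

lemma neg_one_sqrt_sq (m : ℕ) {r : ℝ} (hr : 0 ≤ r) :
    ((-1) ^ m * √r) * ((-1) ^ m * √r) = r := by
  have h1 : ((-1 : ℝ) ^ m) * (-1) ^ m = 1 := by
    rw [← mul_pow]; norm_num
  calc ((-1) ^ m * √r) * ((-1) ^ m * √r) = ((-1) ^ m * (-1) ^ m) * (√r * √r) := by ring
    _ = r := by rw [h1, Real.mul_self_sqrt hr, one_mul]

lemma aeval_quarticPoly_even (z : ℂ) (m : ℕ) : aeval z (quarticPoly (2 * m)) =
    (((-1) ^ m * √(evenWeight m) : ℝ) : ℂ) * evenVal z m := by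
  rw [quarticPoly, stringOrthonormal_even, map_mul, aeval_C, Complex.coe_algebraMap, evenVal]

lemma aeval_quarticPoly_odd (z : ℂ) (m : ℕ) : aeval z (quarticPoly (2 * m + 1)) =
    (((-1) ^ m * √(oddWeight m) : ℝ) : ℂ) * oddVal z m := by
  rw [quarticPoly, stringOrthonormal_odd, map_mul, aeval_C, Complex.coe_algebraMap, oddVal]

lemma eval_zero_quarticPoly (m : ℕ) :
    (quarticPoly (2 * m)).eval 0 = (-1) ^ m * √(evenWeight m) ∧
      (quarticPoly (2 * m + 1)).eval 0 = 0 := by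
  rw [quarticPoly, stringOrthonormal_even, stringOrthonormal_odd, eval_mul, eval_mul, eval_C,
    eval_C, (stringPoly_eval_zero m).1, (stringPoly_eval_zero m).2]
  simp

lemma secondKind_quarticPoly (m : ℕ) :
    (secondKind quarticMoment (quarticPoly (2 * m))).eval 0 = 0 ∧
      (secondKind quarticMoment (quarticPoly (2 * m + 1))).eval 0 = (-1) ^ m * √(oddWeight m) := by
  have h := momentLin_divX_stringPoly evenWeight_zero quarticMoment_of_odd momentLin_quartic m
  rw [secondKind_eval_zero, secondKind_eval_zero, quarticPoly, stringOrthonormal_even,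
    stringOrthonormal_odd, divX_C_mul, divX_C_mul, momentLin_C_mul, momentLin_C_mul, h.1, h.2]
  simp

lemma hasSum_sq_norm_quarticPoly (z : ℂ) :
    HasSum (fun k => ‖aeval z (quarticPoly k)‖ ^ 2)
      (∑' m, evenWeight m * ‖evenVal z m‖ ^ 2 + ∑' m, oddWeight m * ‖oddVal z m‖ ^ 2) := by
  obtain ⟨M, hM⟩ := exists_val_bound z
  have key : ∀ {r x : ℝ} {m : ℕ}, 0 ≤ r → r ≤ 1 / ((m : ℝ) + 1) ^ 2 → 0 ≤ x → x ≤ M →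
      ‖r * x ^ 2‖ ≤ 1 / ((m : ℝ) + 1) ^ 2 * M ^ 2 := by
    intro r x m hr hr' hx hx'
    rw [Real.norm_of_nonneg (by positivity)]
    gcongr
  have s := summable_one_div_succ_sq.mul_right (M ^ 2)
  have he : Summable fun m => evenWeight m * ‖evenVal z m‖ ^ 2 := Summable.of_norm_bounded s
    fun m => key (evenWeight_pos m).le (evenWeight_le m) (norm_nonneg _) (hM m).1
  have ho : Summable fun m => oddWeight m * ‖oddVal z m‖ ^ 2 := Summable.of_norm_bounded s
    fun m => key (oddWeight_pos m).le (oddWeight_le m) (norm_nonneg _) (hM m).2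
  refine HasSum.even_add_odd ?_ ?_
  · convert he.hasSum using 1
    funext m
    rw [aeval_quarticPoly_even, norm_mul, mul_pow, Complex.norm_real, Real.norm_eq_abs, sq_abs,
      sq (_ * √_), neg_one_sqrt_sq m (evenWeight_pos m).le]
  · convert ho.hasSum using 1
    funext m
    rw [aeval_quarticPoly_odd, norm_mul, mul_pow, Complex.norm_real, Real.norm_eq_abs, sq_abs,
      sq (_ * √_), neg_one_sqrt_sq m (oddWeight_pos m).le]

lemma hasSum_secondKind_quarticPoly (z : ℂ) :
    HasSum (fun k => (((secondKind quarticMoment (quarticPoly k)).eval 0 : ℝ) : ℂ) *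
      aeval z (quarticPoly k)) (∑' m, (oddWeight m : ℂ) * oddVal z m) := by
  rw [← zero_add (∑' m, _)]
  refine HasSum.even_add_odd ?_ ?_
  · simp only [(secondKind_quarticPoly _).1, Complex.ofReal_zero, zero_mul]
    exact hasSum_zero
  · convert (summable_oddVal z).hasSum using 1
    funext m
    rw [(secondKind_quarticPoly m).2, aeval_quarticPoly_odd, ← mul_assoc, ← Complex.ofReal_mul,
      neg_one_sqrt_sq m (oddWeight_pos m).le]

lemma hasSum_eval_zero_quarticPoly (z : ℂ) :
    HasSum (fun k => (((quarticPoly k).eval 0 : ℝ) : ℂ) * aeval z (quarticPoly k))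
      (∑' m, (evenWeight m : ℂ) * evenVal z m) := by
  rw [← add_zero (∑' m, _)]
  refine HasSum.even_add_odd ?_ ?_
  · convert (summable_evenVal z).hasSum using 1
    funext m
    rw [(eval_zero_quarticPoly m).1, aeval_quarticPoly_even, ← mul_assoc, ← Complex.ofReal_mul,
      neg_one_sqrt_sq m (evenWeight_pos m).le]
  · simp only [(eval_zero_quarticPoly _).2, Complex.ofReal_zero, zero_mul]
    exact hasSum_zero

lemma nevanlinnaB_quarticPoly (z : ℂ) :
    nevanlinnaB quarticMoment quarticPoly z = -evenLim z := by
  rw [nevanlinnaB, (hasSum_secondKind_quarticPoly z).tsum_eq, evenLim]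
  ring

lemma nevanlinnaD_quarticPoly (z : ℂ) : nevanlinnaD quarticPoly z = oddLim z := by
  rw [nevanlinnaD, (hasSum_eval_zero_quarticPoly z).tsum_eq, oddLim]

/-- On the unit circle `conj z = z⁻¹`, so the sum of squares is the Christoffel-Darboux kernel at
`e^{iθ}` and `e^{-iθ}`. -/
lemma hasSum_circle {θ : ℝ} (hθ : Real.sin θ ≠ 0) :
    HasSum (fun k => ‖aeval (circlePoint θ) (quarticPoly k)‖ ^ 2) (circleKernel θ) := by
  have h := hasSum_sq_norm_quarticPoly (circlePoint θ)
  have hcd := christoffel_darboux (circlePoint θ) (circlePoint (-θ))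
  have hne : circlePoint θ - circlePoint (-θ) ≠ 0 := by
    rw [circlePoint_sub]
    exact mul_ne_zero (by simp) (Complex.ofReal_ne_zero.2 hθ)
  have hlim := lim_circlePoint θ hθ
  rw [← hcd, mul_div_cancel_left₀ _ hne, ← conj_circlePoint] at hlim
  have e : (((∑' m, evenWeight m * ‖evenVal (circlePoint θ) m‖ ^ 2 +
      ∑' m, oddWeight m * ‖oddVal (circlePoint θ) m‖ ^ 2 : ℝ)) : ℂ) = circleKernel θ := by
    rw [← hlim]
    push_cast
    congr 1
    · refine tsum_congr fun m => ?_
      rw [(val_conj _ m).1, Complex.mul_conj']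
    · refine tsum_congr fun m => ?_
      rw [(val_conj _ m).2, Complex.mul_conj']
  rwa [Complex.ofReal_inj.1 e] at h

theorem mainTheorem5 :
    (∃ p : ℕ → Polynomial ℝ, IsOrthonormalPolys quarticMoment p) ∧
    ∀ p : ℕ → Polynomial ℝ, IsOrthonormalPolys quarticMoment p →
      (∀ z : ℂ,
        Summable (fun k => ‖Polynomial.aeval z (p k)‖ ^ 2) ∧
        Summable (fun k => (((secondKind quarticMoment (p k)).eval 0 : ℝ) : ℂ) *
          Polynomial.aeval z (p k)) ∧
        Summable (fun k => (((p k).eval 0 : ℝ) : ℂ) * Polynomial.aeval z (p k))) ∧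
      (∀ θ : ℝ, Real.sin θ ≠ 0 →
        HasSum (fun k => ‖Polynomial.aeval (circlePoint θ) (p k)‖ ^ 2)
          (1 / (Real.pi * Real.sin θ) *
            (Real.sinh (kZero * Real.cos (θ / 2)) * Real.sinh (kZero * Real.sin (θ / 2)) +
              Real.sin (kZero * Real.cos (θ / 2)) * Real.sin (kZero * Real.sin (θ / 2)))) ∧
        (nevanlinnaB quarticMoment p (circlePoint θ) * nevanlinnaD p (circlePoint (-θ)) -
            nevanlinnaB quarticMoment p (circlePoint (-θ)) * nevanlinnaD p (circlePoint θ)) /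
            (circlePoint θ - circlePoint (-θ)) =
          ((1 / (Real.pi * Real.sin θ) *
            (Real.sinh (kZero * Real.cos (θ / 2)) * Real.sinh (kZero * Real.sin (θ / 2)) +
              Real.sin (kZero * Real.cos (θ / 2)) * Real.sin (kZero * Real.sin (θ / 2))) : ℝ) :
            ℂ)) ∧
      IntervalIntegrable
        (fun θ : ℝ => ∑' k, ‖Polynomial.aeval (circlePoint θ) (p k)‖ ^ 2)
        MeasureTheory.volume 0 (2 * Real.pi) ∧
      Summable (fun mn : {mn : ℕ × ℕ // Even (mn.1 + mn.2)} => rhoTerm mn.1.1 mn.1.2) ∧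
      rhoZero p = kZero ^ 2 / Real.pi *
        ∑' mn : {mn : ℕ × ℕ // Even (mn.1 + mn.2)}, rhoTerm mn.1.1 mn.1.2 := by
  refine ⟨⟨_, isOrthonormalPolys_quartic⟩, fun p hp => ?_⟩
  obtain rfl : p = quarticPoly := hp.unique isOrthonormalPolys_quartic
  have hae : circleKernel =ᵐ[MeasureTheory.volume]
      fun θ => ∑' k, ‖aeval (circlePoint θ) (quarticPoly k)‖ ^ 2 := by
    filter_upwards [ae_sin_ne_zero] with θ hθ
    exact (hasSum_circle hθ).tsum_eq.symm
  refine ⟨fun z => ⟨(hasSum_sq_norm_quarticPoly z).summable,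
    (hasSum_secondKind_quarticPoly z).summable, (hasSum_eval_zero_quarticPoly z).summable⟩,
    fun θ hθ => ⟨hasSum_circle hθ, ?_⟩, ?_, hasSum_rhoTerm.summable, ?_⟩
  · refine Eq.trans ?_ (lim_circlePoint θ hθ)
    rw [nevanlinnaB_quarticPoly, nevanlinnaB_quarticPoly, nevanlinnaD_quarticPoly,
      nevanlinnaD_quarticPoly]
    congr 1
    ring
  · exact (intervalIntegrable_circleKernel _ _).congr_ae (MeasureTheory.ae_restrict_of_ae hae)
  · have hI : ∫ θ in (0 : ℝ)..(2 * Real.pi),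
        ∑' k, ‖aeval (circlePoint θ) (quarticPoly k)‖ ^ 2 =
        ∫ θ in (0 : ℝ)..(2 * Real.pi), circleKernel θ :=
      intervalIntegral.integral_congr_ae (by
        filter_upwards [hae] with θ hθ _
        exact hθ.symm)
    have hpi := Real.pi_ne_zero
    have hK := kZero_pos.ne'
    rw [rhoZero, hI, hasSum_rhoTerm.tsum_eq]
    field_simp
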